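/- Let $X_2=\mathrm{PSL}_2(\mathbb Z)\backslash \mathrm{PSL}_2(\mathbb R)=\mathrm{SL}_2(\mathbb Z)\backslash \mathrm{SL}_2(\mathbb R)$, with projection $\pi:\mathrm{SL}_2(\mathbb R)\to X_2$. There is a unique Borel probability measure $\mu_{Haar}$ on $X_2$ that is invariant under right multiplication by $\mathrm{SL}_2(\mathbb R)$. Let $a(t)=\begin{pmatrix}e^{-t/2}&0\\0&e^{t/2}\end{pmatrix}$ and $A=\{a(t):t\in\mathbb R\}$. For $g=\begin{pmatrix}a&b\\c&d\end{pmatrix}$ put $\alpha(g)=a/c$, $\omega(g)=b/d$ (when finite), and let $$C_+=\{g\in A\cdot \mathrm{SO}_2(\mathbb R):\alpha(g)\le -1<0<\omega(g)<1\},\qquad C_-=\{g\in A\cdot \mathrm{SO}_2(\mathbb R):-1<\omega(g)<0<1\le\alpha(g)\},$$ and $C=C_+\cup C_-$. The elements of $C$, up to sign, are parametrized bijectively by $$\tilde Y=\{(y,z):0<y<1,\ 0<z\le \tfrac1{1+y}\}\times\{\pm1\}$$ through $g\mapsto (|\omega(g)|,\,1/|\omega(g)-\alpha(g)|,\,\epsilon)$,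 where $\epsilon=\pm1$ for $g\in C_\pm$; we write $(y,z,\epsilon)$ also for the corresponding point of $\pi(C)$. For $x\in\pi(C)$ let $r_C(x)=\min\{t>0: x\,a(t)\in\pi(C)\}\in(0,\infty]$ be the return time to the cross-section ($r_C(x)=\infty$ if there is no return). Let $\mathrm{Leb}$ be the product of Lebesgue measure on $\mathbb R^2$ and counting measure on $\{\pm1\}$, let $\hat Y=\{(p,t):p\in\tilde Y,\ 0<t<r_C(p)\}$, let $m$ be the restriction of $\mathrm{Leb}\otimes dt$ to $\hat Y$, and let $\theta:\hat Y\to X_2$, $\theta(p,t)=p\,a(t)$. Then, for $\kappa\in\mathbb R$, the formula $$\int_{X_2} f\,d\mu_{Haar}=\kappa\int_{\tilde Y}\Big(\int_0^{r_C(p)}f(p\,a(t))\,dt\Big)\,d\mathrm{Leb}(p)\qquad\text{for all } f\in C_c(X_2)$$ holds if and only if $\kappa=\frac{3}{\pi^2}$; likewise, $\mu_{Haar}=\kappa\,\theta_*m$ (with $\kappa \geq 0$) if and only if $\kappa=\frac3{\pi^2}$. Moreover $\frac{3}{\pi^2}=\frac1{2\zeta(2)}$. -/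

import Mathlib

open MeasureTheory
open scoped ENNReal MatrixGroups

noncomputable section

namespace GaussFlow

/-- `SL₂(ℤ)` as a subgroup of `SL₂(ℝ)`. -/
def Γ : Subgroup SL(2, ℝ) :=
  (Matrix.SpecialLinearGroup.map (n := Fin 2) (Int.castRingHom ℝ)).range

/-- `X₂ = PSL₂(ℤ) \ PSL₂(ℝ)`. As `-1 ∈ SL₂(ℤ)`, this is the space of right cosets
`SL₂(ℤ) g`, `g ∈ SL₂(ℝ)`. -/
def X2 : Type := Quotient (QuotientGroup.rightRel Γ)

/-- The projection `π : SL₂(ℝ) → X₂`. -/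
def proj (g : SL(2, ℝ)) : X2 := Quotient.mk (QuotientGroup.rightRel Γ) g

/-- The quotient topology. -/
instance : TopologicalSpace X2 :=
  inferInstanceAs (TopologicalSpace (Quotient (QuotientGroup.rightRel Γ)))

/-- The Borel `σ`-algebra. -/
instance : MeasurableSpace X2 := borel X2

instance : BorelSpace X2 := ⟨rfl⟩

/-- The right action `x ↦ x h` of the group on `X₂`. -/
def X2.act (x : X2) (h : SL(2, ℝ)) : X2 :=
  Quotient.map (fun g : SL(2, ℝ) => g * h)
    (fun g₁ g₂ hg => by
      change QuotientGroup.rightRel Γ (g₁ * h) (g₂ * h)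
      have hg' : QuotientGroup.rightRel Γ g₁ g₂ := hg
      rw [QuotientGroup.rightRel_apply] at hg' ⊢
      simpa [mul_assoc] using hg') x

theorem proj_act (g h : SL(2, ℝ)) : (proj g).act h = proj (g * h) := rfl

/-- `μ` is an invariant Borel probability measure on `X₂`. -/
def IsHaarProb (μ : Measure X2) : Prop :=
  IsProbabilityMeasure μ ∧ ∀ h : SL(2, ℝ), μ.map (fun x => x.act h) = μ

/-- The flow `a(t) = diag(e^{-t/2}, e^{t/2})`. -/
def a (t : ℝ) : SL(2, ℝ) :=
  ⟨!![Real.exp (-t / 2), 0; 0, Real.exp (t / 2)], by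
    rw [Matrix.det_fin_two_of, ← Real.exp_add]; ring_nf; simp⟩

/-- The endpoint `α(g)` at time `-∞` of the geodesic through `g` (used only when it is finite). -/
def α (g : SL(2, ℝ)) : ℝ := g 0 0 / g 1 0

/-- The endpoint `ω(g)` at time `+∞` of the geodesic through `g` (used only when it is finite). -/
def ω (g : SL(2, ℝ)) : ℝ := g 0 1 / g 1 1

/-- `A · SO₂(ℝ)`: the unit tangent vectors whose base point is on the imaginary axis. -/
def ASO2 : Set SL(2, ℝ) :=
  {g | ∃ (t : ℝ) (k : SL(2, ℝ)),
    (k : Matrix (Fin 2) (Fin 2) ℝ) ∈ Matrix.specialOrthogonalGroup (Fin 2) ℝ ∧ g = a t * k}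

def Cplus : Set SL(2, ℝ) := {g | g ∈ ASO2 ∧ α g ≤ -1 ∧ 0 < ω g ∧ ω g < 1}

def Cminus : Set SL(2, ℝ) := {g | g ∈ ASO2 ∧ -1 < ω g ∧ ω g < 0 ∧ 1 ≤ α g}

/-- The cross-section upstairs; it is stable under `g ↦ -g`, that is, it is (the preimage of)
a subset of `PSL₂(ℝ)`. -/
def C : Set SL(2, ℝ) := Cplus ∪ Cminus

/-- The cross-section `π(C) ⊆ X₂`. -/
def piC : Set X2 := proj '' C

/-- The return time `r_C(x) = min {t > 0 : x a(t) ∈ π(C)}`, equal to `∞` if there is no such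
`t`. -/
def returnTime (x : X2) : EReal :=
  sInf ((fun t : ℝ => (t : EReal)) '' {t : ℝ | 0 < t ∧ x.act (a t) ∈ piC})

/-- The coordinates `(y, z, ε) = (|ω|, 1 / |ω - α|, sign)` on `C`. -/
def coord (g : SL(2, ℝ)) : ℝ × ℝ × ℤˣ :=
  (|ω g|, 1 / |ω g - α g|, if 0 < ω g then 1 else -1)

/-- `Ỹ = {(y, z) : 0 < y < 1, 0 < z ≤ 1 / (1 + y)} × {±1}`, the range of the coordinates. -/
def Ytilde : Set (ℝ × ℝ × ℤˣ) :=
  {p | 0 < p.1 ∧ p.1 < 1 ∧ 0 < p.2.1 ∧ p.2.1 ≤ 1 / (1 + p.1)}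

theorem unit_sq (ε : ℤˣ) : (((ε : ℤ) : ℝ)) * ((ε : ℤ) : ℝ) = 1 := by
  rcases Int.units_eq_one_or ε with h | h <;> simp [h]

/-- The matrix with rows `(1 - yz, εy)` and `(-εz, 1)`. -/
def endMat (p : ℝ × ℝ × ℤˣ) : SL(2, ℝ) :=
  ⟨!![1 - p.1 * p.2.1, ((p.2.2 : ℤ) : ℝ) * p.1; -(((p.2.2 : ℤ) : ℝ) * p.2.1), 1], by
    rw [Matrix.det_fin_two_of]
    linear_combination p.1 * p.2.1 * unit_sq p.2.2⟩

/-- The element of `C` (unique up to sign) with coordinates `p ∈ Ỹ`; see `crossMat_spec` and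
`eq_crossMat_coord`. -/
def crossMat (p : ℝ × ℝ × ℤˣ) : SL(2, ℝ) :=
  endMat p * a (Real.log (p.2.1 * (1 - p.1 * p.2.1) / p.1) / 2)

/-- The point of `π(C)` with coordinates `p ∈ Ỹ`. -/
def crossPoint (p : ℝ × ℝ × ℤˣ) : X2 := proj (crossMat p)

/-- Lebesgue measure on `ℝ² × {±1}` (counting measure on the last factor). -/
def lebY : Measure (ℝ × ℝ × ℤˣ) :=
  (volume : Measure ℝ).prod ((volume : Measure ℝ).prod (Measure.count : Measure ℤˣ))

/-- `Ŷ = {(p, t) : p ∈ Ỹ, 0 < t < r_C(p)}`. -/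
def Yhat : Set ((ℝ × ℝ × ℤˣ) × ℝ) :=
  {q | q.1 ∈ Ytilde ∧ 0 < q.2 ∧ (q.2 : EReal) < returnTime (crossPoint q.1)}

/-- `θ(p, t) = p · a(t)`. -/
def θ (q : (ℝ × ℝ × ℤˣ) × ℝ) : X2 := (crossPoint q.1).act (a q.2)

/-- The restriction to `Ŷ` of the product measure. -/
def suspMeasure : Measure ((ℝ × ℝ × ℤˣ) × ℝ) :=
  (lebY.prod (volume : Measure ℝ)).restrict Yhat

/-- The disintegration of `μ` along the flow with constant `κ`: for all `f ∈ C_c(X₂)`,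
`∫ f dμ = κ ∫_Ỹ ∫_0^{r_C} f(p a(t)) dt dp`. -/
def OrbitFormula (μ : Measure X2) (κ : ℝ) : Prop :=
  ∀ f : X2 → ℝ, Continuous f → HasCompactSupport f →
    ∫ x, f x ∂μ = κ * ∫ p in Ytilde,
      (∫ t in {t : ℝ | 0 < t ∧ (t : EReal) < returnTime (crossPoint p)},
        f ((crossPoint p).act (a t))) ∂lebY

theorem a_mul_zero (t : ℝ) (g : SL(2, ℝ)) (j : Fin 2) :
    (a t * g) 0 j = Real.exp (-t / 2) * g 0 j := by
  rw [Matrix.SpecialLinearGroup.coe_mul, Matrix.mul_apply, Fin.sum_univ_two]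
  simp [a]

theorem a_mul_one (t : ℝ) (g : SL(2, ℝ)) (j : Fin 2) :
    (a t * g) 1 j = Real.exp (t / 2) * g 1 j := by
  rw [Matrix.SpecialLinearGroup.coe_mul, Matrix.mul_apply, Fin.sum_univ_two]
  simp [a]

theorem mul_a_zero (t : ℝ) (g : SL(2, ℝ)) (i : Fin 2) :
    (g * a t) i 0 = g i 0 * Real.exp (-t / 2) := by
  rw [Matrix.SpecialLinearGroup.coe_mul, Matrix.mul_apply, Fin.sum_univ_two]
  simp [a]

theorem mul_a_one (t : ℝ) (g : SL(2, ℝ)) (i : Fin 2) :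
    (g * a t) i 1 = g i 1 * Real.exp (t / 2) := by
  rw [Matrix.SpecialLinearGroup.coe_mul, Matrix.mul_apply, Fin.sum_univ_two]
  simp [a]

theorem exp_half_mul (t : ℝ) : Real.exp (-t / 2) * Real.exp (t / 2) = 1 := by
  rw [← Real.exp_add]; ring_nf; simp

theorem det_eq (g : SL(2, ℝ)) : g 0 0 * g 1 1 - g 0 1 * g 1 0 = 1 := by
  rw [← Matrix.det_fin_two]; exact g.det_coe

theorem mem_ASO2_iff (g : SL(2, ℝ)) :
    g ∈ ASO2 ↔ g 0 0 * g 1 0 + g 0 1 * g 1 1 = 0 := by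
  constructor
  · rintro ⟨t, k, hk, rfl⟩
    rw [Matrix.mem_specialUnitaryGroup_iff] at hk
    have h := (Matrix.mem_orthogonalGroup_iff (Fin 2) ℝ).1 hk.1
    have h01 := congrFun (congrFun h 0) 1
    simp [Matrix.mul_apply, Fin.sum_univ_two] at h01
    rw [a_mul_zero, a_mul_zero, a_mul_one, a_mul_one]
    linear_combination Real.exp (-t / 2) * Real.exp (t / 2) * h01
  · intro h
    have hdet := det_eq g
    set s : ℝ := g 0 0 ^ 2 + g 0 1 ^ 2 with hs
    have hs1 : s * (g 1 0 ^ 2 + g 1 1 ^ 2) = 1 := by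
      rw [hs]
      linear_combination (g 0 0 * g 1 1 - g 0 1 * g 1 0 + 1) * hdet +
        (g 0 0 * g 1 0 + g 0 1 * g 1 1) * h
    have hs0 : 0 < s := by
      rcases (by positivity : (0 : ℝ) ≤ s).eq_or_lt with h0 | h0
      · rw [← h0] at hs1; simp at hs1
      · exact h0
    have e1 : Real.exp (Real.log s / 2) * Real.exp (Real.log s / 2) = s := by
      rw [← Real.exp_add]; ring_nf; exact Real.exp_log hs0
    have e3 := exp_half_mul (Real.log s)
    refine ⟨-Real.log s, a (Real.log s) * g, ?_, ?_⟩
    · rw [Matrix.mem_specialUnitaryGroup_iff]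
      refine ⟨?_, Matrix.SpecialLinearGroup.det_coe _⟩
      rw [Matrix.mem_orthogonalGroup_iff]
      ext i j
      rw [Matrix.mul_apply, Fin.sum_univ_two]
      set u := Real.exp (Real.log s / 2) with hu
      set v := Real.exp (-Real.log s / 2) with hv
      fin_cases i <;> fin_cases j <;>
        simp only [Fin.zero_eta, Fin.mk_one, Matrix.transpose_apply, a_mul_zero, a_mul_one,
          Matrix.one_apply, ← hu, ← hv] <;> norm_num
      · have : v * v * s = 1 := by rw [← e1]; linear_combination (v * u + 1) * e3
        linear_combination this - v * v * hs
      · linear_combination u * v * h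
      · linear_combination u * v * h
      · linear_combination (g 1 0 ^ 2 + g 1 1 ^ 2) * e1 + hs1
    · have e4 : Real.exp (- -Real.log s / 2) = Real.exp (Real.log s / 2) := by ring_nf
      ext i j
      fin_cases i
      · simp only [Fin.zero_eta, a_mul_zero, e4]
        linear_combination -g 0 j * e3
      · simp only [Fin.mk_one, a_mul_one]
        linear_combination -g 1 j * e3

theorem mem_Ytilde_aux {p : ℝ × ℝ × ℤˣ} (hp : p ∈ Ytilde) : p.1 * p.2.1 + p.2.1 ≤ 1 := by
  obtain ⟨h1, h2, h3, h4⟩ := hp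
  rw [le_div_iff₀ (by linarith)] at h4
  linarith

theorem crossMat_spec {p : ℝ × ℝ × ℤˣ} (hp : p ∈ Ytilde) :
    crossMat p ∈ C ∧ coord (crossMat p) = p := by
  have h5 := mem_Ytilde_aux hp
  obtain ⟨y, z, ε⟩ := p
  obtain ⟨h1, h2, h3, h4⟩ := hp
  simp only at h1 h2 h3 h4 h5
  have hx : 0 < z * (1 - y * z) / y := div_pos (mul_pos h3 (by linarith)) h1
  obtain ⟨w, hw⟩ : ∃ w, w = Real.log (z * (1 - y * z) / y) / 2 := ⟨_, rfl⟩
  have hw2 : Real.exp (w / 2) ^ 4 * y = z * (1 - y * z) := by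
    have : Real.exp (w / 2) ^ 4 = z * (1 - y * z) / y := by
      rw [← Real.exp_nat_mul, hw, ← Real.exp_log hx]
      congr 1
      rw [Real.exp_log hx]; push_cast; ring
    rw [this]; field_simp
  have huv := exp_half_mul w
  have hu := Real.exp_pos (-w / 2)
  have hv := Real.exp_pos (w / 2)
  have m00 : crossMat (y, z, ε) 0 0 = (1 - y * z) * Real.exp (-w / 2) := by
    rw [crossMat, mul_a_zero, hw]; simp [endMat]
  have m01 : crossMat (y, z, ε) 0 1 = ((ε : ℤ) : ℝ) * y * Real.exp (w / 2) := by
    rw [crossMat, mul_a_one, hw]; simp [endMat]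
  have m10 : crossMat (y, z, ε) 1 0 = -(((ε : ℤ) : ℝ) * z) * Real.exp (-w / 2) := by
    rw [crossMat, mul_a_zero, hw]; simp [endMat]
  have m11 : crossMat (y, z, ε) 1 1 = Real.exp (w / 2) := by
    rw [crossMat, mul_a_one, hw]; simp [endMat]
  set u := Real.exp (-w / 2)
  set v := Real.exp (w / 2)
  have hmem : crossMat (y, z, ε) ∈ ASO2 := by
    rw [mem_ASO2_iff, m00, m01, m10, m11]
    linear_combination u ^ 2 * ((ε : ℤ) : ℝ) * hw2 -
      ((ε : ℤ) : ℝ) * y * v ^ 2 * (u * v + 1) * huv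
  have hω : ω (crossMat (y, z, ε)) = ((ε : ℤ) : ℝ) * y := by
    rw [ω, m01, m11]; field_simp
  have hq : 1 ≤ (1 - y * z) / z := by rw [le_div_iff₀ h3]; linarith
  have key : y + (1 - y * z) / z = 1 / z := by field_simp; ring
  rcases Int.units_eq_one_or ε with rfl | rfl
  · have hα : α (crossMat (y, z, 1)) = -((1 - y * z) / z) := by
      rw [α, m00, m10]; simp only [Units.val_one, Int.cast_one]; field_simp
    simp only [Units.val_one, Int.cast_one, one_mul] at hω
    refine ⟨Or.inl ⟨hmem, ?_, ?_, ?_⟩, ?_⟩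
    · rw [hα]; linarith
    · rwa [hω]
    · rwa [hω]
    · rw [coord, hα, hω, sub_neg_eq_add, key, abs_of_pos h1, abs_of_pos (by positivity), if_pos h1]
      simp
  · have hα : α (crossMat (y, z, -1)) = (1 - y * z) / z := by
      rw [α, m00, m10]; simp only [Units.val_neg, Units.val_one, Int.cast_neg, Int.cast_one]
      field_simp
    simp only [Units.val_neg, Units.val_one, Int.cast_neg, Int.cast_one, neg_one_mul] at hω
    refine ⟨Or.inr ⟨hmem, ?_, ?_, ?_⟩, ?_⟩
    · rw [hω]; linarith
    · rw [hω]; linarith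
    · rw [hα]; linarith
    · rw [coord, hα, hω, ← neg_add', key, abs_neg, abs_neg, abs_of_pos h1,
        abs_of_pos (by positivity), if_neg (by linarith)]
      simp

theorem eq_crossMat_coord {g : SL(2, ℝ)} (hg : g ∈ C) :
    coord g ∈ Ytilde ∧ (g = crossMat (coord g) ∨ g = -crossMat (coord g)) := by
  -- it suffices to find the coordinates up to sign
  suffices h : ∃ p ∈ Ytilde, g = crossMat p ∨ g = -crossMat p by
    obtain ⟨p, hp, h⟩ := h
    have hneg : ∀ k : SL(2, ℝ), coord (-k) = coord k := by
      intro k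
      have h1 : ω (-k) = ω k := by simp [ω, neg_div_neg_eq]
      have h2 : α (-k) = α k := by simp [α, neg_div_neg_eq]
      unfold coord
      rw [h1, h2]
    have hc : coord g = p := by
      rcases h with rfl | rfl
      · exact (crossMat_spec hp).2
      · rw [hneg]; exact (crossMat_spec hp).2
    rw [hc]; exact ⟨hp, h⟩
  -- the conditions that define `C`, for a general sign
  obtain ⟨ε, hA, hα, hω0, hω1⟩ : ∃ ε : ℤˣ, g ∈ ASO2 ∧ ((ε : ℤ) : ℝ) * α g ≤ -1 ∧
      0 < ((ε : ℤ) : ℝ) * ω g ∧ ((ε : ℤ) : ℝ) * ω g < 1 := by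
    rcases hg with ⟨h0, h1, h2, h3⟩ | ⟨h0, h1, h2, h3⟩
    · exact ⟨1, h0, by simpa using h1, by simpa using h2, by simpa using h3⟩
    · refine ⟨-1, h0, ?_, ?_, ?_⟩ <;> simp <;> linarith
  rw [mem_ASO2_iff] at hA
  have hdet := det_eq g
  have hε := unit_sq ε
  unfold α at hα
  unfold ω at hω0 hω1
  obtain ⟨e, he⟩ : ∃ e : ℝ, e = ((ε : ℤ) : ℝ) := ⟨_, rfl⟩
  rw [← he] at hα hω0 hω1 hε
  have hc : g 1 0 ≠ 0 := by
    intro h; rw [h] at hα; simp at hα; linarith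
  have hd : g 1 1 ≠ 0 := by
    intro h; rw [h] at hω0; simp at hω0
  obtain ⟨y, hy⟩ : ∃ y, y = e * (g 0 1 / g 1 1) := ⟨_, rfl⟩
  obtain ⟨z, hz⟩ : ∃ z, z = -(e * (g 1 0 * g 1 1)) := ⟨_, rfl⟩
  have hyb : y * g 1 1 = e * g 0 1 := by rw [hy]; field_simp
  have hyz : 1 - y * z = g 0 0 * g 1 1 := by
    linear_combination -y * hz + e * g 1 0 * hyb + g 0 1 * g 1 0 * hε - hdet
  rw [← hy] at hω0 hω1
  -- `z` is the inverse of `ε (ω - α)`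
  have hzi : z * (y - e * (g 0 0 / g 1 0)) = 1 := by
    have : e * (g 0 0 / g 1 0) * z = - (g 0 0 * g 1 1) := by
      have hac : g 0 0 / g 1 0 * g 1 0 = g 0 0 := div_mul_cancel₀ _ hc
      linear_combination e * (g 0 0 / g 1 0) * hz - e * e * g 1 1 * hac - g 0 0 * g 1 1 * hε
    linear_combination -hyz - this
  have hz0 : 0 < z := by
    by_contra hcon
    have : z * (y - e * (g 0 0 / g 1 0)) ≤ 0 :=
      mul_nonpos_of_nonpos_of_nonneg (not_lt.1 hcon) (by linarith)
    linarith
  have hz1 : z ≤ 1 / (1 + y) := by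
    rw [le_div_iff₀ (by linarith)]
    calc z * (1 + y) ≤ z * (y - e * (g 0 0 / g 1 0)) :=
          mul_le_mul_of_nonneg_left (by linarith) hz0.le
      _ = 1 := hzi
  refine ⟨(y, z, ε), ⟨hω0, hω1, hz0, hz1⟩, ?_⟩
  have hlog : Real.log (z * (1 - y * z) / y) / 2 / 2 = Real.log |g 1 1| := by
    have : z * (1 - y * z) / y = |g 1 1| ^ 4 := by
      have h4 : |g 1 1| ^ 4 = g 1 1 ^ 4 := by
        rw [show (4 : ℕ) = 2 * 2 from rfl, pow_mul, pow_mul, sq_abs]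
      rw [h4, div_eq_iff hω0.ne', hyz, hz]
      linear_combination -(e * g 1 1 ^ 2) * hA - g 1 1 ^ 3 * hyb
    rw [this, Real.log_pow]; push_cast; ring
  have hv : Real.exp (Real.log (z * (1 - y * z) / y) / 2 / 2) = |g 1 1| := by
    rw [hlog, Real.exp_log (abs_pos.2 hd)]
  have hu : Real.exp (-(Real.log (z * (1 - y * z) / y) / 2) / 2) = |g 1 1|⁻¹ := by
    rw [neg_div, Real.exp_neg, hv]
  have m00 : crossMat (y, z, ε) 0 0 = (1 - y * z) * |g 1 1|⁻¹ := by
    rw [crossMat, mul_a_zero, hu]; simp [endMat]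
  have m01 : crossMat (y, z, ε) 0 1 = e * y * |g 1 1| := by
    rw [crossMat, mul_a_one, hv]; simp [endMat, he]
  have m10 : crossMat (y, z, ε) 1 0 = -(e * z) * |g 1 1|⁻¹ := by
    rw [crossMat, mul_a_zero, hu]; simp [endMat, he]
  have m11 : crossMat (y, z, ε) 1 1 = |g 1 1| := by
    rw [crossMat, mul_a_one, hv]; simp [endMat]
  have hey : e * y * g 1 1 = g 0 1 := by
    linear_combination e * hyb + g 0 1 * hε
  have hez : e * z = - (g 1 0 * g 1 1) := by
    rw [hz]; linear_combination -(g 1 0 * g 1 1) * hε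
  rcases lt_or_gt_of_ne hd with hneg | hpos
  · right
    rw [abs_of_neg hneg] at m00 m01 m10 m11
    ext i j
    rw [Matrix.SpecialLinearGroup.coe_neg, Matrix.neg_apply]
    fin_cases i <;> fin_cases j <;> simp only [Fin.zero_eta, Fin.mk_one]
    · rw [m00, hyz]; field_simp
    · rw [m01]; linear_combination -hey
    · rw [m10, hez]; field_simp
    · rw [m11]; ring
  · left
    rw [abs_of_pos hpos] at m00 m01 m10 m11
    ext i j
    fin_cases i <;> fin_cases j <;> simp only [Fin.zero_eta, Fin.mk_one]
    · rw [m00, hyz]; field_simp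
    · rw [m01]; linear_combination -hey
    · rw [m10, hez]; field_simp
    · rw [m11]

end GaussFlow

end

/-! Regard g ∈ SL₂(ℝ) as a lattice basis with rows (A, B), (C, D). Then Γ changes the basis of a
lattice, and a(t) rescales its two coordinates. Call a basis reduced if AD > 0 > BC, |C| ≤ |A| and
|B| < |D|. This is the endpoint condition in the definition of C (`mem_C_iff`). It is invariant
under the flow, and the flow line of a reduced g meets C exactly once, at `crossTime g`. A generic
lattice has many reduced bases: a continued fraction step turns one with second column of sizes b <
d into one with sizes b' < b.

The return time is never computed. Instead, a fundamental domain of Γ is obtained by selecting one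
reduced basis of each generic lattice, in two ways. Selecting the last visit to the translates of C
before time 0 gives `visitDomain`, which in the coordinates (p, t) is Ŷ up to a null set
(`mem_visitDomain_iff`). Selecting by size, |B| ≤ 1 < |D|, gives `columnDomain`, which consists of p
∈ Ỹ and 0 < s ≤ -2 log y in the coordinates `endMat p * a s`. In both systems Haar measure is
Lebesgue measure (`lintegral_coordMeasure`), and the two domains induce the same measure
`quotMeasure` on X₂ (`map_proj_restrict`). Hence θ_* m equals `quotMeasure` (`map_θ_suspMeasure`),
and its mass is 2 ∫₀¹ (-2 log y)/(1 + y) dy = 4 · π²/12 = π²/3.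

An invariant probability measure is absolutely continuous with respect to `quotMeasure`, by Fubini,
and its density is invariant, hence constant. So it is (3/π²) `quotMeasure`. A test function with
positive integral, or the total mass, excludes every other κ. -/

noncomputable section

namespace GaussFlow

/-! ### Integral matrices acting on lattice bases -/

/-- The inclusion of `SL₂(ℤ)` in `SL₂(ℝ)`. -/
def toReal (γ : SL(2, ℤ)) : SL(2, ℝ) := Matrix.SpecialLinearGroup.map (Int.castRingHom ℝ) γ

theorem toReal_mem (γ : SL(2, ℤ)) : toReal γ ∈ Γ := ⟨γ, rfl⟩

theorem exists_toReal_eq {h : SL(2, ℝ)} (hh : h ∈ Γ) : ∃ γ, h = toReal γ := by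
  obtain ⟨γ, rfl⟩ := hh
  exact ⟨γ, rfl⟩

theorem toReal_mul (γ δ : SL(2, ℤ)) : toReal (γ * δ) = toReal γ * toReal δ := map_mul _ _ _

theorem toReal_apply (γ : SL(2, ℤ)) (i j : Fin 2) : toReal γ i j = (γ i j : ℝ) := rfl

theorem toReal_mul_apply (γ : SL(2, ℤ)) (g : SL(2, ℝ)) (i j : Fin 2) :
    (toReal γ * g) i j = γ i 0 * g 0 j + γ i 1 * g 1 j := by
  rw [Matrix.SpecialLinearGroup.coe_mul, Matrix.mul_apply, Fin.sum_univ_two]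
  rfl

theorem toReal_one : toReal 1 = 1 := map_one _

theorem toReal_neg (γ : SL(2, ℤ)) : toReal (-γ) = -toReal γ := by
  ext i j
  simp [toReal_apply]

theorem neg_apply (g : SL(2, ℝ)) (i j : Fin 2) : (-g) i j = -g i j := by
  rw [Matrix.SpecialLinearGroup.coe_neg, Matrix.neg_apply]

/-- The integral matrix with rows `(m, n)`, `(k, l)`. -/
def intMat (m n k l : ℤ) (h : m * l - n * k = 1) : SL(2, ℤ) :=
  ⟨!![m, n; k, l], by rw [Matrix.det_fin_two_of, h]⟩

theorem intMat_mul_zero {m n k l : ℤ} (h : m * l - n * k = 1) (g : SL(2, ℝ)) (j : Fin 2) :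
    (toReal (intMat m n k l h) * g) 0 j = m * g 0 j + n * g 1 j := by
  rw [toReal_mul_apply]; simp [intMat]

theorem intMat_mul_one {m n k l : ℤ} (h : m * l - n * k = 1) (g : SL(2, ℝ)) (j : Fin 2) :
    (toReal (intMat m n k l h) * g) 1 j = k * g 0 j + l * g 1 j := by
  rw [toReal_mul_apply]; simp [intMat]

/-- No nonzero vector of the lattice spanned by the rows of `g` is on a coordinate axis. -/
def NoAxisVector (g : SL(2, ℝ)) : Prop :=
  ∀ (j : Fin 2) (m n : ℤ), (m : ℝ) * g 0 j + n * g 1 j = 0 → m = 0 ∧ n = 0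

theorem int_det (γ : SL(2, ℤ)) : γ 0 0 * γ 1 1 - γ 0 1 * γ 1 0 = 1 := by
  rw [← Matrix.det_fin_two]; exact γ.det_coe

theorem NoAxisVector.int_mul {g : SL(2, ℝ)} (hg : NoAxisVector g) (γ : SL(2, ℤ)) :
    NoAxisVector (toReal γ * g) := by
  intro j m n h
  rw [toReal_mul_apply, toReal_mul_apply] at h
  obtain ⟨h1, h2⟩ := hg j (m * γ 0 0 + n * γ 1 0) (m * γ 0 1 + n * γ 1 1) (by
    push_cast; linear_combination h)
  have hd := int_det γ
  constructor
  · linear_combination γ 1 1 * h1 - γ 1 0 * h2 - m * hd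
  · linear_combination γ 0 0 * h2 - γ 0 1 * h1 - n * hd

theorem NoAxisVector.ne_zero {g : SL(2, ℝ)} (hg : NoAxisVector g) (i j : Fin 2) : g i j ≠ 0 := by
  intro h
  fin_cases i
  · simpa using (hg j 1 0 (by simpa using h)).1
  · simpa using (hg j 0 1 (by simpa using h)).2

/-! ### Reduced bases -/

/-- The endpoints of the geodesic satisfy `α ω < 0`, `|α| ≥ 1` and `|ω| < 1`. -/
def IsReduced (g : SL(2, ℝ)) : Prop :=
  0 < g 0 0 * g 1 1 ∧ g 0 1 * g 1 0 < 0 ∧ |g 1 0| ≤ |g 0 0| ∧ |g 0 1| < |g 1 1|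

theorem isReduced_neg {g : SL(2, ℝ)} : IsReduced (-g) ↔ IsReduced g := by
  simp [IsReduced, neg_apply]

theorem abs_mul_a_zero (g : SL(2, ℝ)) (t : ℝ) (i : Fin 2) :
    |(g * a t) i 0| = |g i 0| * Real.exp (-t / 2) := by
  rw [mul_a_zero, abs_mul, Real.abs_exp]

theorem abs_mul_a_one (g : SL(2, ℝ)) (t : ℝ) (i : Fin 2) :
    |(g * a t) i 1| = |g i 1| * Real.exp (t / 2) := by
  rw [mul_a_one, abs_mul, Real.abs_exp]

theorem isReduced_mul_a {g : SL(2, ℝ)} (t : ℝ) : IsReduced (g * a t) ↔ IsReduced g := by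
  have h1 : (g * a t) 0 0 * (g * a t) 1 1 = g 0 0 * g 1 1 := by
    rw [mul_a_zero, mul_a_one]; linear_combination g 0 0 * g 1 1 * exp_half_mul t
  have h2 : (g * a t) 0 1 * (g * a t) 1 0 = g 0 1 * g 1 0 := by
    rw [mul_a_zero, mul_a_one]; linear_combination g 0 1 * g 1 0 * exp_half_mul t
  rw [IsReduced, IsReduced, h1, h2, abs_mul_a_zero, abs_mul_a_zero, abs_mul_a_one, abs_mul_a_one,
    mul_le_mul_iff_left₀ (Real.exp_pos _), mul_lt_mul_iff_left₀ (Real.exp_pos _)]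

/-- The product AD · BC equals αω(CD)², so it has the sign of αω. As AD - BC = 1, a negative product
forces AD > 0 > BC. -/
theorem mem_C_iff {g : SL(2, ℝ)} : g ∈ C ↔ g ∈ ASO2 ∧ IsReduced g := by
  have hdet := det_eq g
  constructor
  · intro h
    have key : g ∈ ASO2 ∧ g 1 0 ≠ 0 ∧ g 1 1 ≠ 0 ∧ α g * ω g < 0 ∧ 1 ≤ |α g| ∧ |ω g| < 1 := by
      rcases h with ⟨h0, h1, h2, h3⟩ | ⟨h0, h1, h2, h3⟩
      · refine ⟨h0, ?_, ?_, ?_, ?_, ?_⟩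
        · intro hc; simp [α, hc] at h1; linarith
        · intro hc; simp [ω, hc] at h2
        · exact mul_neg_of_neg_of_pos (by linarith) h2
        · rw [abs_of_neg (by linarith)]; linarith
        · rwa [abs_of_pos h2]
      · refine ⟨h0, ?_, ?_, ?_, ?_, ?_⟩
        · intro hc; simp [α, hc] at h3; linarith
        · intro hc; simp [ω, hc] at h2
        · exact mul_neg_of_pos_of_neg (by linarith) h2
        · rw [abs_of_pos (by linarith)]; linarith
        · rw [abs_of_neg h2]; linarith
    obtain ⟨h0, hc, hd, h1, h2, h3⟩ := key
    have hω : ω g * g 1 1 = g 0 1 := div_mul_cancel₀ _ hd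
    have hα : α g * g 1 0 = g 0 0 := div_mul_cancel₀ _ hc
    have h4 : (g 0 0 * g 1 1) * (g 0 1 * g 1 0) < 0 := by
      have : (g 0 0 * g 1 1) * (g 0 1 * g 1 0) = α g * ω g * (g 1 0 * g 1 1) ^ 2 := by
        rw [← hω, ← hα]; ring
      rw [this]
      exact mul_neg_of_neg_of_pos h1 (by positivity)
    refine ⟨h0, ?_, ?_, ?_, ?_⟩
    · rcases mul_neg_iff.1 h4 with h | h
      · exact h.1
      · linarith [h.1, h.2]
    · rcases mul_neg_iff.1 h4 with h | h
      · exact h.2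
      · linarith [h.1, h.2]
    · rw [← hα, abs_mul]; exact le_mul_of_one_le_left (abs_nonneg _) h2
    · rw [← hω, abs_mul]; exact mul_lt_of_lt_one_left (abs_pos.2 hd) h3
  · rintro ⟨h0, h1, h2, h3, h4⟩
    have hd : g 1 1 ≠ 0 := fun h => by simp [h] at h1
    have hc : g 1 0 ≠ 0 := fun h => by simp [h] at h2
    have hω : ω g * g 1 1 = g 0 1 := div_mul_cancel₀ _ hd
    have hα : α g * g 1 0 = g 0 0 := div_mul_cancel₀ _ hc
    have h5 : |ω g| < 1 := by
      rw [← hω, abs_mul] at h4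
      exact (mul_lt_iff_lt_one_left (abs_pos.2 hd)).1 h4
    have h6 : 1 ≤ |α g| := by
      rw [← hα, abs_mul] at h3
      exact (le_mul_iff_one_le_left (abs_pos.2 hc)).1 h3
    have h7 : α g * ω g < 0 := by
      have h4 : (g 0 0 * g 1 1) * (g 0 1 * g 1 0) < 0 := mul_neg_of_pos_of_neg h1 h2
      have : (g 0 0 * g 1 1) * (g 0 1 * g 1 0) = α g * ω g * (g 1 0 * g 1 1) ^ 2 := by
        rw [← hω, ← hα]; ring
      rw [this] at h4
      by_contra hcon
      have := mul_nonneg (not_lt.1 hcon) (sq_nonneg (g 1 0 * g 1 1))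
      linarith
    rw [abs_lt] at h5
    rcases mul_neg_iff.1 h7 with h | h
    · right
      rw [abs_of_pos h.1] at h6
      exact ⟨h0, h5.1, h.2, h6⟩
    · left
      rw [abs_of_neg h.1] at h6
      exact ⟨h0, by linarith, h.2, h5.2⟩

/-- `g` has rows `(a, εb)` and `(-εc, d)` with `a, b, c, d > 0` and `ε = ±1`. -/
structure HasShape (g : SL(2, ℝ)) (ε : ℤ) (a b c d : ℝ) : Prop where
  sq : ε * ε = 1
  a_pos : 0 < a
  b_pos : 0 < b
  c_pos : 0 < c
  d_pos : 0 < d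
  h00 : g 0 0 = a
  h01 : g 0 1 = ε * b
  h10 : g 1 0 = -(ε * c)
  h11 : g 1 1 = d

namespace HasShape

variable {g : SL(2, ℝ)} {ε : ℤ} {a b c d : ℝ}

theorem sqR (h : HasShape g ε a b c d) : (ε : ℝ) * ε = 1 := by exact_mod_cast h.sq

theorem det (h : HasShape g ε a b c d) : a * d + b * c = 1 := by
  have := det_eq g
  rw [h.h00, h.h01, h.h10, h.h11] at this
  linear_combination this - b * c * h.sqR

theorem abs_eps (h : HasShape g ε a b c d) : |(ε : ℝ)| = 1 := by
  rcases mul_self_eq_one_iff.1 h.sqR with e | e <;> simp [e]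

theorem abs01 (h : HasShape g ε a b c d) : |g 0 1| = b := by
  rw [h.h01, abs_mul, h.abs_eps, one_mul, abs_of_pos h.b_pos]

theorem abs10 (h : HasShape g ε a b c d) : |g 1 0| = c := by
  rw [h.h10, abs_neg, abs_mul, h.abs_eps, one_mul, abs_of_pos h.c_pos]

theorem isReduced (h : HasShape g ε a b c d) (hc : c ≤ a) (hb : b < d) : IsReduced g := by
  refine ⟨?_, ?_, ?_, ?_⟩
  · rw [h.h00, h.h11]; exact mul_pos h.a_pos h.d_pos
  · have := mul_pos h.b_pos h.c_pos
    rw [h.h01, h.h10]; linear_combination this - b * c * h.sqR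
  · rwa [h.abs10, h.h00, abs_of_pos h.a_pos]
  · rwa [h.abs01, h.h11, abs_of_pos h.d_pos]

end HasShape

theorem exists_hasShape {g : SL(2, ℝ)} (h0 : 0 < g 0 0) (h1 : 0 < g 1 1)
    (h2 : g 0 1 * g 1 0 < 0) : ∃ ε : ℤ, HasShape g ε (g 0 0) |g 0 1| |g 1 0| (g 1 1) := by
  rcases mul_neg_iff.1 h2 with h | h
  · exact ⟨1, by norm_num, h0, abs_pos.2 h.1.ne', abs_pos.2 h.2.ne, h1, rfl,
      by simp [abs_of_pos h.1], by simp [abs_of_neg h.2], rfl⟩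
  · exact ⟨-1, by norm_num, h0, abs_pos.2 h.1.ne, abs_pos.2 h.2.ne', h1, rfl,
      by simp [abs_of_neg h.1], by simp [abs_of_pos h.2], rfl⟩

theorem IsReduced.exists_hasShape {g : SL(2, ℝ)} (h : IsReduced g) (hd : 0 < g 1 1) :
    ∃ (ε : ℤ) (a b c d : ℝ), HasShape g ε a b c d ∧ c ≤ a ∧ b < d := by
  obtain ⟨h1, h2, h3, h4⟩ := h
  have ha : 0 < g 0 0 := pos_of_mul_pos_left h1 hd.le
  obtain ⟨ε, hε⟩ := GaussFlow.exists_hasShape ha hd h2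
  rw [abs_of_pos ha] at h3
  rw [abs_of_pos hd] at h4
  exact ⟨ε, _, _, _, _, hε, h3, h4⟩

/-! ### Continued fraction steps -/

theorem exists_int_remainder {x y : ℝ} (hy : 0 < y) (hyx : y ≤ x)
    (hne : ∀ k : ℤ, x - k * y ≠ 0) : ∃ k : ℤ, 1 ≤ k ∧ 0 < x - k * y ∧ x - k * y < y := by
  have h1 := Int.floor_le (x / y)
  have h2 := Int.lt_floor_add_one (x / y)
  rw [le_div_iff₀ hy] at h1
  rw [div_lt_iff₀ hy] at h2
  refine ⟨⌊x / y⌋, ?_, ?_, by linarith⟩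
  · rw [Int.le_floor, le_div_iff₀ hy]; simpa using hyx
  · exact lt_of_le_of_ne (by linarith) (hne _).symm

namespace HasShape

variable {g : SL(2, ℝ)} {ε : ℤ} {a b c d : ℝ}

theorem translate (h : HasShape g ε a b c d) {k : ℤ} (hk : 1 ≤ k) (hb : 0 < b - k * d) :
    ∃ γ, HasShape (toReal γ * g) ε (a + k * c) (b - k * d) c d := by
  have hk' : (1 : ℝ) ≤ k := by exact_mod_cast hk
  have hs := h.sqR
  have := mul_pos (by linarith : (0 : ℝ) < k) h.c_pos
  refine ⟨intMat 1 (-(ε * k)) 0 1 (by ring), h.sq, by linarith [h.a_pos], hb, h.c_pos, h.d_pos,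
    ?_, ?_, ?_, ?_⟩
  · rw [intMat_mul_zero, h.h00, h.h10]; push_cast; linear_combination k * c * hs
  · rw [intMat_mul_zero, h.h01, h.h11]; push_cast; ring
  · rw [intMat_mul_one, h.h00, h.h10]; push_cast; ring
  · rw [intMat_mul_one, h.h01, h.h11]; push_cast; ring

/-- The Gauss map on bases: the second column (b, d) becomes (d - kb, b), and the sign ε flips, so
that steps alternate between C₊ and C₋. -/
theorem forward (h : HasShape g ε a b c d) {k : ℤ} (hk : 1 ≤ k) (hb : 0 < d - k * b) :
    ∃ γ, HasShape (toReal γ * g) (-ε) (k * a + c) (d - k * b) a b := by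
  have hk' : (1 : ℝ) ≤ k := by exact_mod_cast hk
  have hs := h.sqR
  have := mul_pos (by linarith : (0 : ℝ) < k) h.a_pos
  refine ⟨intMat k (-ε) ε 0 (by linear_combination h.sq), by linear_combination h.sq,
    by linarith [h.c_pos], hb, h.a_pos, h.b_pos, ?_, ?_, ?_, ?_⟩
  · rw [intMat_mul_zero, h.h00, h.h10]; push_cast; linear_combination c * hs
  · rw [intMat_mul_zero, h.h01, h.h11]; push_cast; ring
  · rw [intMat_mul_one, h.h00, h.h10]; push_cast; ring
  · rw [intMat_mul_one, h.h01, h.h11]; push_cast; linear_combination b * hs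

/-- The inverse step, a division in the first column. The value l = 0 is allowed and exchanges the
two rows up to sign. -/
theorem backward (h : HasShape g ε a b c d) {l : ℤ} (hl : 0 ≤ l) (hc : 0 < a - l * c) :
    ∃ γ, HasShape (toReal γ * g) (-ε) c d (a - l * c) (l * d + b) := by
  have hl' : (0 : ℝ) ≤ l := by exact_mod_cast hl
  have hs := h.sqR
  have := mul_nonneg hl' h.d_pos.le
  refine ⟨intMat 0 (-ε) ε l (by linear_combination h.sq), by linear_combination h.sq,
    h.c_pos, h.d_pos, hc, by linarith [h.b_pos], ?_, ?_, ?_, ?_⟩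
  · rw [intMat_mul_zero, h.h00, h.h10]; push_cast; linear_combination c * hs
  · rw [intMat_mul_zero, h.h01, h.h11]; push_cast; ring
  · rw [intMat_mul_one, h.h00, h.h10]; push_cast; ring
  · rw [intMat_mul_one, h.h01, h.h11]; linear_combination b * hs

theorem noAxis_left (h : HasShape g ε a b c d) (hg : NoAxisVector g) (m n : ℤ)
    (h0 : (m : ℝ) * a + n * c = 0) : m = 0 ∧ n = 0 := by
  have hs := h.sqR
  obtain ⟨h1, h2⟩ := hg 0 m (-(n * ε)) (by
    rw [h.h00, h.h10]; push_cast; linear_combination h0 + n * c * hs)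
  exact ⟨h1, by linear_combination -ε * h2 - n * h.sq⟩

theorem noAxis_right (h : HasShape g ε a b c d) (hg : NoAxisVector g) (m n : ℤ)
    (h0 : (m : ℝ) * b + n * d = 0) : m = 0 ∧ n = 0 := by
  have hs := h.sqR
  obtain ⟨h1, h2⟩ := hg 1 (m * ε) n (by
    rw [h.h01, h.h11]; push_cast; linear_combination h0 + m * b * hs)
  exact ⟨by linear_combination ε * h1 - m * h.sq, h2⟩

end HasShape

/-- A normalised form of `IsReduced` with explicit entries. -/
def ReducedShape (g : SL(2, ℝ)) (b d : ℝ) : Prop :=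
  ∃ (ε : ℤ) (a c : ℝ), HasShape g ε a b c d ∧ c ≤ a ∧ b < d

/-- Take b' to be the remainder of d modulo b, with quotient at least 1. Remainders never vanish
since no lattice vector lies on an axis. The bound b' + b ≤ d is what makes repeated steps contract.
-/
theorem ReducedShape.forward {g : SL(2, ℝ)} (hg : NoAxisVector g) {b d : ℝ}
    (h : ReducedShape g b d) : ∃ γ b', ReducedShape (toReal γ * g) b' b ∧ b' < b ∧ b' + b ≤ d := by
  obtain ⟨ε, a, c, h, hc, hb⟩ := h
  obtain ⟨k, hk, h1, h2⟩ := exists_int_remainder h.b_pos hb.le (fun k hk => by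
    have := (h.noAxis_right hg (-k) 1 (by push_cast; linear_combination hk)).2
    omega)
  obtain ⟨γ, hγ⟩ := h.forward hk h1
  have hk' : (1 : ℝ) ≤ k := by exact_mod_cast hk
  have h3 : a ≤ k * a := le_mul_of_one_le_left h.a_pos.le hk'
  have h4 : b ≤ k * b := le_mul_of_one_le_left h.b_pos.le hk'
  exact ⟨γ, _, ⟨_, _, _, hγ, by linarith [h.c_pos], h2⟩, h2, by linarith⟩

theorem ReducedShape.backward {g : SL(2, ℝ)} (hg : NoAxisVector g) {b d : ℝ}
    (h : ReducedShape g b d) : ∃ γ d', ReducedShape (toReal γ * g) d d' ∧ d + b ≤ d' := by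
  obtain ⟨ε, a, c, h, hc, hb⟩ := h
  obtain ⟨l, hl, h1, h2⟩ := exists_int_remainder h.c_pos hc (fun k hk => by
    have := (h.noAxis_left hg 1 (-k) (by push_cast; linear_combination hk)).1
    omega)
  obtain ⟨γ, hγ⟩ := h.backward (by omega) h1
  have hl' : (1 : ℝ) ≤ l := by exact_mod_cast hl
  have h4 : d ≤ l * d := le_mul_of_one_le_left h.d_pos.le hl'
  exact ⟨γ, _, ⟨_, _, _, hγ, h2.le, by linarith [h.b_pos]⟩, by linarith⟩

/-- Two forward steps at least halve b, since b₂ < b₁ and b₂ + b₁ ≤ b. The descent stops when the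
smaller entry first drops to 1 or below; the larger entry is then the preceding one, still above 1.
-/
theorem ReducedShape.exists_le_of_le {g : SL(2, ℝ)} (hg : NoAxisVector g) (n : ℕ) {b d : ℝ}
    (h : ReducedShape g b d) (hd : 1 < d) (hn : b ≤ 2 ^ n) :
    ∃ γ b' d', ReducedShape (toReal γ * g) b' d' ∧ b' ≤ 1 ∧ 1 < d' := by
  induction n generalizing g b d with
  | zero => exact ⟨1, b, d, by rwa [toReal_one, one_mul], by simpa using hn, hd⟩
  | succ n ih =>
    rcases le_or_gt b 1 with hb | hb
    · exact ⟨1, b, d, by rwa [toReal_one, one_mul], hb, hd⟩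
    obtain ⟨γ₁, b₁, h₁, hb₁, -⟩ := h.forward hg
    rcases le_or_gt b₁ 1 with hb1 | hb1
    · exact ⟨γ₁, b₁, b, h₁, hb1, hb⟩
    obtain ⟨γ₂, b₂, h₂, hb₂, hs⟩ := h₁.forward (hg.int_mul γ₁)
    obtain ⟨γ₃, b₃, d₃, h₃⟩ := ih ((hg.int_mul γ₁).int_mul γ₂) h₂ hb1 (by
      rw [pow_succ] at hn; linarith)
    refine ⟨γ₃ * (γ₂ * γ₁), b₃, d₃, ?_⟩
    rwa [toReal_mul, toReal_mul, mul_assoc, mul_assoc]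

/-- The mirror image: two backward steps at least double d, since d₂ ≥ d₁ + d and d₁ ≥ d. -/
theorem ReducedShape.exists_of_ge {g : SL(2, ℝ)} (hg : NoAxisVector g) (n : ℕ) {b d : ℝ}
    (h : ReducedShape g b d) (hb : b ≤ 1) (hn : 1 ≤ 2 ^ n * d) :
    ∃ γ b' d', ReducedShape (toReal γ * g) b' d' ∧ b' ≤ 1 ∧ 1 < d' := by
  induction n generalizing g b d with
  | zero =>
    rcases ne_or_eq d 1 with hd | hd
    · exact ⟨1, b, d, by rwa [toReal_one, one_mul], hb, lt_of_le_of_ne (by simpa using hn) hd.symm⟩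
    -- If d = 1 exactly, one more backward step makes 1 the smaller entry, and the larger one is at
    -- least 1 + b.
    · obtain ⟨γ, d', h', hd'⟩ := h.backward hg
      obtain ⟨_, _, _, h, -⟩ := h
      exact ⟨γ, d, d', h', hd.le, by linarith [h.b_pos]⟩
  | succ n ih =>
    rcases le_or_gt d 1 with hd | hd
    swap
    · exact ⟨1, b, d, by rwa [toReal_one, one_mul], hb, hd⟩
    obtain ⟨γ₁, d₁, h₁, hd₁⟩ := h.backward hg
    rcases le_or_gt d₁ 1 with hd1 | hd1
    swap
    · exact ⟨γ₁, d, d₁, h₁, hd, hd1⟩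
    obtain ⟨γ₂, d₂, h₂, hd₂⟩ := h₁.backward (hg.int_mul γ₁)
    have hb0 : 0 < b := by obtain ⟨_, _, _, h, -⟩ := h; exact h.b_pos
    obtain ⟨γ₃, b₃, d₃, h₃⟩ := ih ((hg.int_mul γ₁).int_mul γ₂) h₂ hd1 (by
      calc 1 ≤ 2 ^ (n + 1) * d := hn
        _ = 2 ^ n * (2 * d) := by ring
        _ ≤ 2 ^ n * d₂ := by gcongr; linarith)
    refine ⟨γ₃ * (γ₂ * γ₁), b₃, d₃, ?_⟩
    rwa [toReal_mul, toReal_mul, mul_assoc, mul_assoc]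

theorem ReducedShape.exists_normalized {g : SL(2, ℝ)} (hg : NoAxisVector g) {b d : ℝ}
    (h : ReducedShape g b d) :
    ∃ γ b' d', ReducedShape (toReal γ * g) b' d' ∧ b' ≤ 1 ∧ 1 < d' := by
  rcases le_or_gt b 1 with hb | hb
  · have hd0 : 0 < d := by obtain ⟨_, _, _, h, -⟩ := h; exact h.d_pos
    obtain ⟨n, hn⟩ := pow_unbounded_of_one_lt d⁻¹ one_lt_two
    refine h.exists_of_ge hg n hb ?_
    rw [inv_lt_iff_one_lt_mul₀ hd0] at hn
    exact hn.le
  · obtain ⟨n, hn⟩ := pow_unbounded_of_one_lt b one_lt_two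
    have : b < d := by obtain ⟨_, _, _, h⟩ := h; exact h.2.2
    exact h.exists_le_of_le hg n (by linarith) hn.le

/-- If d < b, subtracting multiples of the second row from the first (up to sign) reduces b below d,
and the new a is at least c. If b < d but a < c, exchanging the rows leads back to that case. -/
theorem HasShape.exists_reducedShape {g : SL(2, ℝ)} (hg : NoAxisVector g) {ε : ℤ} {a b c d : ℝ}
    (h : HasShape g ε a b c d) : ∃ γ b' d', ReducedShape (toReal γ * g) b' d' := by
  have key : ∀ {g : SL(2, ℝ)} (hg : NoAxisVector g) {ε : ℤ} {a b c d : ℝ}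
      (h : HasShape g ε a b c d) (hdb : d < b), ∃ γ b' d', ReducedShape (toReal γ * g) b' d' := by
    intro g hg ε a b c d h hdb
    obtain ⟨k, hk, h1, h2⟩ := exists_int_remainder h.d_pos hdb.le (fun k hk => by
      have := (h.noAxis_right hg 1 (-k) (by push_cast; linear_combination hk)).1
      omega)
    obtain ⟨γ, hγ⟩ := h.translate hk h1
    have hk' : (1 : ℝ) ≤ k := by exact_mod_cast hk
    have h3 : c ≤ k * c := le_mul_of_one_le_left h.c_pos.le hk'
    exact ⟨γ, _, _, _, _, _, hγ, by linarith [h.a_pos], h2⟩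
  rcases lt_or_ge d b with hdb | hdb
  · exact key hg h hdb
  have hbd : b < d := lt_of_le_of_ne hdb (fun e => by
    have := (h.noAxis_right hg 1 (-1) (by push_cast; linear_combination e)).1
    omega)
  rcases le_or_gt c a with hca | hca
  · exact ⟨1, b, d, ε, a, c, by rwa [toReal_one, one_mul], hca, hbd⟩
  obtain ⟨γ, hγ⟩ := h.backward le_rfl (by simpa using h.a_pos)
  have hγ' : HasShape (toReal γ * g) (-ε) c d a b := by simpa using hγ
  obtain ⟨δ, b', d', h'⟩ := key (hg.int_mul γ) hγ' hbd
  exact ⟨δ * γ, b', d', by rwa [toReal_mul, mul_assoc]⟩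

theorem exists_hasShape_of_mul_neg {g : SL(2, ℝ)} (h : g 0 0 * g 1 1 * (g 0 1 * g 1 0) < 0) :
    ∃ (γ : SL(2, ℤ)) (ε : ℤ) (a b c d : ℝ), HasShape (toReal γ * g) ε a b c d := by
  have hdet := det_eq g
  have h1 : 0 < g 0 0 * g 1 1 ∧ g 0 1 * g 1 0 < 0 := by
    rcases mul_neg_iff.1 h with h | h
    · exact h
    · linarith [h.1, h.2]
  rcases mul_pos_iff.1 h1.1 with h2 | h2
  · obtain ⟨ε, h3⟩ := exists_hasShape h2.1 h2.2 h1.2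
    exact ⟨1, ε, _, _, _, _, by rw [toReal_one, one_mul]; exact h3⟩
  · obtain ⟨ε, h3⟩ := exists_hasShape (g := -g) (by rw [neg_apply]; linarith)
      (by rw [neg_apply]; linarith) (by simpa [neg_apply] using h1.2)
    exact ⟨-1, ε, _, _, _, _, by rw [toReal_neg, toReal_one, neg_one_mul]; exact h3⟩

/-! ### Every generic lattice has a reduced basis -/

/-- Every lattice has a basis `(A, B), (C, D)` with `|CD| < 1`. -/
theorem exists_abs_mul_lt_one (g : SL(2, ℝ)) :
    ∃ γ : SL(2, ℤ), |(toReal γ * g) 1 0 * (toReal γ * g) 1 1| < 1 := by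
  obtain ⟨γ, hγ⟩ := ModularGroup.exists_smul_mem_fd (g • UpperHalfPlane.I)
  refine ⟨γ, ?_⟩
  have h := ModularGroup.three_le_four_mul_im_sq_of_mem_fd hγ
  have e : γ • g • UpperHalfPlane.I = (toReal γ * g) • UpperHalfPlane.I := by
    rw [mul_smul]
    apply UpperHalfPlane.ext
    rw [UpperHalfPlane.coe_specialLinearGroup_apply γ,
      UpperHalfPlane.coe_specialLinearGroup_apply (toReal γ)]
    simp [toReal_apply]
  rw [e] at h
  set k := toReal γ * g
  have hdet := det_eq k
  have hpos : 0 < k 1 0 ^ 2 + k 1 1 ^ 2 := by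
    by_contra hcon
    have h0 : k 1 0 = 0 := by nlinarith [sq_nonneg (k 1 0), sq_nonneg (k 1 1)]
    have h1 : k 1 1 = 0 := by nlinarith [sq_nonneg (k 1 0), sq_nonneg (k 1 1)]
    rw [h0, h1] at hdet; simp at hdet
  have him : (k • UpperHalfPlane.I).im * (k 1 0 ^ 2 + k 1 1 ^ 2) = 1 := by
    have h1 := congrArg Complex.im (UpperHalfPlane.coe_specialLinearGroup_apply k UpperHalfPlane.I)
    rw [UpperHalfPlane.coe_im] at h1
    rw [h1, Complex.div_im]
    simp [Complex.normSq_apply]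
    have hinv : (k 1 0 ^ 2 + k 1 1 ^ 2)⁻¹ * (k 1 0 ^ 2 + k 1 1 ^ 2) = 1 := inv_mul_cancel₀ hpos.ne'
    linear_combination (k 1 0 ^ 2 + k 1 1 ^ 2)⁻¹ * (k 1 0 ^ 2 + k 1 1 ^ 2) * hdet + hinv
  set s := k 1 0 ^ 2 + k 1 1 ^ 2 with hs
  -- On the fundamental domain the imaginary part is at least √3/2, and it is 1/s, so s ≤ 2/√3 < 2.
  -- Then 2|CD| ≤ s gives the claim.
  have hs2 : s < 2 := by
    by_contra hcon
    have him0 := (k • UpperHalfPlane.I).im_pos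
    nlinarith
  rw [abs_lt]
  constructor <;> nlinarith [sq_nonneg (k 1 0 + k 1 1), sq_nonneg (k 1 0 - k 1 1)]

/-- The endpoints satisfy |α - ω| = 1/|CD| > 1 for a suitable basis, so the floor of the larger one
lies strictly between them. Translating it to 0 gives endpoints of opposite sign, from which a
reduced basis is reached. -/
theorem NoAxisVector.exists_reducedShape {g : SL(2, ℝ)} (hg : NoAxisVector g) :
    ∃ γ b d, ReducedShape (toReal γ * g) b d := by
  suffices h : ∃ γ : SL(2, ℤ), (toReal γ * g) 0 0 * (toReal γ * g) 1 1 *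
      ((toReal γ * g) 0 1 * (toReal γ * g) 1 0) < 0 by
    obtain ⟨γ, h⟩ := h
    obtain ⟨γ₁, ε, a, b, c, d, h₁⟩ := exists_hasShape_of_mul_neg h
    obtain ⟨γ₂, b', d', h₂⟩ := h₁.exists_reducedShape ((hg.int_mul γ).int_mul γ₁)
    exact ⟨γ₂ * (γ₁ * γ), b', d', by rwa [toReal_mul, toReal_mul, mul_assoc, mul_assoc]⟩
  obtain ⟨γ, h⟩ := exists_abs_mul_lt_one g
  have hk := hg.int_mul γ
  set k := toReal γ * g with hkdef
  have hdet := det_eq k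
  have hc := hk.ne_zero 1 0
  have hd := hk.ne_zero 1 1
  -- an integer between the two endpoints
  obtain ⟨n, hn⟩ : ∃ n : ℤ, (k 0 0 / k 1 0 - n) * (k 0 1 / k 1 1 - n) < 0 := by
    have hne : ∀ (j : Fin 2) (n : ℤ), k 0 j / k 1 j - n ≠ 0 := by
      intro j n h0
      have := (hk j 1 (-n) (by
        have hj := hk.ne_zero 1 j
        rw [sub_eq_zero, div_eq_iff hj] at h0
        push_cast; linear_combination h0)).1
      omega
    have hdiff : (k 0 0 / k 1 0 - k 0 1 / k 1 1) * (k 1 0 * k 1 1) = 1 := by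
      field_simp; linear_combination hdet
    have hgt : 1 < |k 0 0 / k 1 0 - k 0 1 / k 1 1| := by
      have := congrArg abs hdiff
      rw [abs_mul, abs_one] at this
      by_contra hcon
      have : |k 0 0 / k 1 0 - k 0 1 / k 1 1| * |k 1 0 * k 1 1| < 1 :=
        mul_lt_one_of_nonneg_of_lt_one_right (not_lt.1 hcon) (abs_nonneg _) h
      linarith
    have aux : ∀ x y : ℝ, y - ⌊y⌋ ≠ 0 → x + 1 < y → (x - ⌊y⌋) * (y - ⌊y⌋) < 0 := by
      intro x y hy hxy
      have h1 := Int.floor_le y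
      have h2 := Int.lt_floor_add_one y
      exact mul_neg_of_neg_of_pos (by linarith) (lt_of_le_of_ne (by linarith) hy.symm)
    rcases lt_abs.1 hgt with h | h
    · refine ⟨⌊k 0 0 / k 1 0⌋, ?_⟩
      rw [mul_comm]
      exact aux _ _ (hne 0 _) (by linarith)
    · exact ⟨⌊k 0 1 / k 1 1⌋, aux _ _ (hne 1 _) (by linarith)⟩
  refine ⟨intMat 1 (-n) 0 1 (by ring) * γ, ?_⟩
  have e : toReal (intMat 1 (-n) 0 1 (by ring) * γ) * g =
      toReal (intMat 1 (-n) 0 1 (by ring)) * k := by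
    rw [toReal_mul, mul_assoc]
  simp only [e, intMat_mul_zero, intMat_mul_one]
  have : (k 0 0 / k 1 0 - n) * (k 0 1 / k 1 1 - n) * (k 1 0 * k 1 1) ^ 2 < 0 :=
    mul_neg_of_neg_of_pos hn (by positivity)
  convert this using 1
  push_cast
  field_simp
  ring

theorem NoAxisVector.exists_normalized {g : SL(2, ℝ)} (hg : NoAxisVector g) :
    ∃ γ b d, ReducedShape (toReal γ * g) b d ∧ b ≤ 1 ∧ 1 < d := by
  obtain ⟨γ, b, d, h⟩ := hg.exists_reducedShape
  obtain ⟨δ, b', d', h'⟩ := h.exists_normalized (hg.int_mul γ)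
  exact ⟨δ * γ, b', d', by rwa [toReal_mul, mul_assoc]⟩

/-! ### Crossings of the imaginary axis -/

theorem a_add (s t : ℝ) : a (s + t) = a s * a t := by
  ext i j
  fin_cases i
  · simp only [Fin.zero_eta, a_mul_zero]
    fin_cases j <;> simp [a]
    rw [← Real.exp_add]; ring_nf
  · simp only [Fin.mk_one, a_mul_one]
    fin_cases j <;> simp [a]
    rw [← Real.exp_add]; ring_nf

theorem a_zero : a 0 = 1 := by
  ext i j
  fin_cases i <;> fin_cases j <;> simp [a]

/-- The time at which the geodesic through `g` crosses the imaginary axis. -/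
def crossTime (g : SL(2, ℝ)) : ℝ := Real.log (-(g 0 0 * g 1 0) / (g 0 1 * g 1 1)) / 2

theorem crossTime_neg (g : SL(2, ℝ)) : crossTime (-g) = crossTime g := by
  simp [crossTime, neg_apply]

theorem IsReduced.quot_pos {g : SL(2, ℝ)} (h : IsReduced g) :
    0 < -(g 0 0 * g 1 0) / (g 0 1 * g 1 1) := by
  obtain ⟨h1, h2, -⟩ := h
  have hq : g 0 1 * g 1 1 ≠ 0 := by
    intro h0
    rcases mul_eq_zero.1 h0 with h0 | h0
    · simp [h0] at h2
    · simp [h0] at h1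
  have : -(g 0 0 * g 1 0) / (g 0 1 * g 1 1) =
      (g 0 0 * g 1 1) * (-(g 0 1 * g 1 0)) / (g 0 1 * g 1 1) ^ 2 := by
    field_simp
  rw [this]
  exact div_pos (mul_pos h1 (by linarith)) (by positivity)

/-- Membership in A · SO₂ is orthogonality of the rows, which for g a(t) reads AC e^{-t} + BD e^{t}
= 0. This has exactly one solution when AC and BD have opposite signs. -/
theorem IsReduced.mul_a_mem_ASO2_iff {g : SL(2, ℝ)} (h : IsReduced g) (t : ℝ) :
    g * a t ∈ ASO2 ↔ t = crossTime g := by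
  have hpos := h.quot_pos
  have hq : g 0 1 * g 1 1 ≠ 0 := by
    intro h0; rw [h0, div_zero] at hpos; exact lt_irrefl _ hpos
  have hE := exp_half_mul t
  have hE2 : Real.exp (2 * t) = Real.exp (t / 2) ^ 4 := by
    rw [← Real.exp_nat_mul]; ring_nf
  have h1 : t = crossTime g ↔ Real.exp (2 * t) = -(g 0 0 * g 1 0) / (g 0 1 * g 1 1) := by
    rw [crossTime]
    constructor
    · intro h
      rw [h, mul_div_cancel₀ _ two_ne_zero, Real.exp_log hpos]
    · intro h
      rw [← h, Real.log_exp, mul_div_cancel_left₀ _ two_ne_zero]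
  rw [h1, eq_div_iff hq, mem_ASO2_iff, mul_a_zero, mul_a_zero, mul_a_one, mul_a_one, hE2]
  set u := Real.exp (-t / 2)
  set v := Real.exp (t / 2)
  constructor
  · intro h
    linear_combination v ^ 2 * h - (u * v + 1) * g 0 0 * g 1 0 * hE
  · intro h
    linear_combination u ^ 2 * h - (u * v + 1) * (g 0 1 * g 1 1) * v ^ 2 * hE

theorem IsReduced.crossTime_mul_a {g : SL(2, ℝ)} (h : IsReduced g) (s : ℝ) :
    crossTime (g * a s) = crossTime g - s := by
  symm
  rw [← ((isReduced_mul_a s).2 h).mul_a_mem_ASO2_iff, mul_assoc, ← a_add, h.mul_a_mem_ASO2_iff]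
  ring

theorem IsReduced.mul_a_mem_C {g : SL(2, ℝ)} (h : IsReduced g) : g * a (crossTime g) ∈ C :=
  mem_C_iff.2 ⟨(h.mul_a_mem_ASO2_iff _).2 rfl, (isReduced_mul_a _).2 h⟩

/-- Generic elements: the endpoints are irrational and the base point is on no translate of the
imaginary axis. -/
def IsGeneric (g : SL(2, ℝ)) : Prop := NoAxisVector g ∧ ∀ γ, toReal γ * g ∉ ASO2

theorem IsGeneric.int_mul {g : SL(2, ℝ)} (hg : IsGeneric g) (γ : SL(2, ℤ)) :
    IsGeneric (toReal γ * g) :=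
  ⟨hg.1.int_mul γ, fun δ => by rw [← mul_assoc, ← toReal_mul]; exact hg.2 _⟩

theorem row_sq_mul_row_sq {g : SL(2, ℝ)} (hg : g ∈ ASO2) :
    (g 0 0 ^ 2 + g 0 1 ^ 2) * (g 1 0 ^ 2 + g 1 1 ^ 2) = 1 := by
  rw [mem_ASO2_iff] at hg
  have hdet := det_eq g
  linear_combination (g 0 0 * g 1 1 - g 0 1 * g 1 0 + 1) * hdet +
    (g 0 0 * g 1 0 + g 0 1 * g 1 1) * hg

/-- The sum of the squares of the entries. -/
def sqNorm (g : SL(2, ℝ)) : ℝ := g 0 0 ^ 2 + g 0 1 ^ 2 + (g 1 0 ^ 2 + g 1 1 ^ 2)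

/-- The integral row is recovered from the row of γg by multiplying by g⁻¹, whose entries are those
of g up to sign and place; then apply Cauchy–Schwarz. -/
theorem int_row_sq_le (γ : SL(2, ℤ)) (g : SL(2, ℝ)) (i : Fin 2) :
    (γ i 0 : ℝ) ^ 2 + (γ i 1 : ℝ) ^ 2 ≤
      ((toReal γ * g) i 0 ^ 2 + (toReal γ * g) i 1 ^ 2) * sqNorm g := by
  have hdet := det_eq g
  have h0 : (γ i 0 : ℝ) = (toReal γ * g) i 0 * g 1 1 - (toReal γ * g) i 1 * g 1 0 := by
    rw [toReal_mul_apply, toReal_mul_apply]; linear_combination -(γ i 0 : ℝ) * hdet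
  have h1 : (γ i 1 : ℝ) = (toReal γ * g) i 1 * g 0 0 - (toReal γ * g) i 0 * g 0 1 := by
    rw [toReal_mul_apply, toReal_mul_apply]; linear_combination -(γ i 1 : ℝ) * hdet
  rw [h0, h1, sqNorm]
  generalize (toReal γ * g) i 0 = x
  generalize (toReal γ * g) i 1 = y
  nlinarith [sq_nonneg (x * g 1 0 + y * g 1 1), sq_nonneg (x * g 0 0 + y * g 0 1)]

theorem one_le_int_row_sq (γ : SL(2, ℤ)) (i : Fin 2) :
    1 ≤ (γ i 0 : ℝ) ^ 2 + (γ i 1 : ℝ) ^ 2 := by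
  have : 0 < (γ i 0) ^ 2 + (γ i 1) ^ 2 := by
    by_contra hcon
    have h0 : γ i 0 = 0 := by nlinarith [sq_nonneg (γ i 0), sq_nonneg (γ i 1)]
    have h1 : γ i 1 = 0 := by nlinarith [sq_nonneg (γ i 0), sq_nonneg (γ i 1)]
    have hd := int_det γ
    fin_cases i <;> simp_all
  exact_mod_cast this

theorem finite_int_bounded (N : ℤ) : {γ : SL(2, ℤ) | ∀ i j, |γ i j| ≤ N}.Finite := by
  have h : (Set.pi Set.univ fun _ : Fin 2 => Set.pi Set.univ fun _ : Fin 2 =>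
      Set.Icc (-N) N).Finite :=
    Set.Finite.pi fun _ => Set.Finite.pi fun _ => Set.finite_Icc _ _
  refine Set.Finite.of_finite_image (f := fun (γ : SL(2, ℤ)) (i j : Fin 2) => γ i j)
    (h.subset ?_) ?_
  · rintro _ ⟨γ, hγ, rfl⟩ i - j -
    exact abs_le.1 (hγ i j)
  · intro γ _ δ _ hγδ
    ext i j
    exact congrFun (congrFun hγδ i) j

/-- The squared row lengths x, y of γ g a(t) satisfy xy = 1 on the imaginary axis, and xS, yS ≥ 1
with S the sum of squares of the entries of g a(t), because integral rows have length at least 1. So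
x, y ≤ S, and the entries of γ are at most S, which is bounded for |t| ≤ T. -/
theorem finite_crossings (g : SL(2, ℝ)) (T : ℝ) :
    {γ : SL(2, ℤ) | ∃ t, |t| ≤ T ∧ toReal γ * g * a t ∈ ASO2}.Finite := by
  obtain ⟨N, hN⟩ := exists_int_gt (sqNorm g * Real.exp T)
  refine (finite_int_bounded N).subset ?_
  rintro γ ⟨t, ht, hA⟩
  have hS : sqNorm (g * a t) ≤ sqNorm g * Real.exp T := by
    have e1 : Real.exp (-t / 2) ^ 2 ≤ Real.exp T := by
      rw [← Real.exp_nat_mul, Real.exp_le_exp]; push_cast; linarith [neg_abs_le t]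
    have e2 : Real.exp (t / 2) ^ 2 ≤ Real.exp T := by
      rw [← Real.exp_nat_mul, Real.exp_le_exp]; push_cast; linarith [le_abs_self t]
    simp only [sqNorm, mul_a_zero, mul_a_one, mul_pow, add_mul]
    gcongr
  rw [mul_assoc] at hA
  have hprod := row_sq_mul_row_sq hA
  have h0 := int_row_sq_le γ (g * a t) 0
  have h1 := int_row_sq_le γ (g * a t) 1
  have l0 := one_le_int_row_sq γ 0
  have l1 := one_le_int_row_sq γ 1
  set x := (toReal γ * (g * a t)) 0 0 ^ 2 + (toReal γ * (g * a t)) 0 1 ^ 2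
  set y := (toReal γ * (g * a t)) 1 0 ^ 2 + (toReal γ * (g * a t)) 1 1 ^ 2
  have hx0 : 0 ≤ x := by positivity
  have hy0 : 0 ≤ y := by positivity
  set S := sqNorm (g * a t)
  have hx : x ≤ S := by
    calc x ≤ x * (y * S) := le_mul_of_one_le_right hx0 (by linarith)
      _ = S := by linear_combination S * hprod
  have hy : y ≤ S := by
    calc y ≤ y * (x * S) := le_mul_of_one_le_right hy0 (by linarith)
      _ = S := by linear_combination S * hprod
  have hS0 : 0 ≤ S := hx0.trans hx
  have key : ∀ i j, (γ i j : ℝ) ^ 2 ≤ S ^ 2 := by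
    have b0 : x * S ≤ S ^ 2 := by rw [sq]; gcongr
    have b1 : y * S ≤ S ^ 2 := by rw [sq]; gcongr
    have s00 := sq_nonneg (γ 0 0 : ℝ)
    have s01 := sq_nonneg (γ 0 1 : ℝ)
    have s10 := sq_nonneg (γ 1 0 : ℝ)
    have s11 := sq_nonneg (γ 1 1 : ℝ)
    intro i j
    fin_cases i <;> fin_cases j <;> simp only [Fin.zero_eta, Fin.mk_one] <;> linarith
  intro i j
  have := abs_le_of_sq_le_sq (key i j) hS0
  have h3 : ((|γ i j| : ℤ) : ℝ) ≤ N := by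
    rw [Int.cast_abs]; exact this.trans (hS.trans hN.le)
  exact_mod_cast h3

/-- An element of `SL₂(ℤ)` that maps a point of the imaginary axis to a point of the imaginary
axis and respects the conditions on the endpoints is `±1`. -/
theorem eq_one_or_neg_one_of_mem_C {g : SL(2, ℝ)} {γ : SL(2, ℤ)} (hg : g ∈ C)
    (hγ : toReal γ * g ∈ C) : γ = 1 ∨ γ = -1 := by
  rw [mem_C_iff] at hg hγ
  obtain ⟨hA, h1, h2, h3, h4⟩ := hg
  obtain ⟨hA', h1', h2', h3', h4'⟩ := hγ
  rw [mem_ASO2_iff] at hA hA'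
  have hd := int_det γ
  simp only [toReal_mul_apply] at hA' h3' h4'
  have hX : 0 < g 0 0 ^ 2 + g 0 1 ^ 2 := by
    have : g 0 0 ≠ 0 := fun h => by simp [h] at h1
    positivity
  have hY : 0 < g 1 0 ^ 2 + g 1 1 ^ 2 := by
    have : g 1 1 ≠ 0 := fun h => by simp [h] at h1
    positivity
  set X := g 0 0 ^ 2 + g 0 1 ^ 2 with hXd
  set Y := g 1 0 ^ 2 + g 1 1 ^ 2 with hYd
  have horth : ((γ 0 0 * γ 1 0 : ℤ) : ℝ) * X + ((γ 0 1 * γ 1 1 : ℤ) : ℝ) * Y = 0 := by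
    push_cast
    linear_combination hA' - (γ 0 0 * γ 1 1 + γ 0 1 * γ 1 0 : ℝ) * hA
  -- both products vanish, as their product is `n (n + 1)` for an integer `n`
  have hle : (γ 0 0 * γ 1 0) * (γ 0 1 * γ 1 1) ≤ 0 := by
    have hle' : ((γ 0 0 * γ 1 0 : ℤ) : ℝ) * ((γ 0 1 * γ 1 1 : ℤ) : ℝ) ≤ 0 := by
      set p := ((γ 0 0 * γ 1 0 : ℤ) : ℝ)
      set q := ((γ 0 1 * γ 1 1 : ℤ) : ℝ)
      by_contra hcon
      have : p * q * Y = -(p ^ 2 * X) := by linear_combination p * horth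
      have h5 := mul_pos (not_le.1 hcon) hY
      have h6 := mul_nonneg (sq_nonneg p) hX.le
      linarith
    exact_mod_cast hle'
  have hge : 0 ≤ (γ 0 0 * γ 1 0) * (γ 0 1 * γ 1 1) := by
    have e : (γ 0 0 * γ 1 0) * (γ 0 1 * γ 1 1) = (γ 0 1 * γ 1 0) * (γ 0 1 * γ 1 0 + 1) := by
      linear_combination γ 0 1 * γ 1 0 * hd
    rw [e]
    rcases le_or_gt 0 (γ 0 1 * γ 1 0) with h | h
    · positivity
    · exact mul_nonneg_of_nonpos_of_nonpos h.le (by omega)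
  have h0 : γ 0 0 * γ 1 0 = 0 ∧ γ 0 1 * γ 1 1 = 0 := by
    rcases mul_eq_zero.1 (le_antisymm hle hge) with h | h
    · rw [h, Int.cast_zero, zero_mul, zero_add] at horth
      exact ⟨h, by exact_mod_cast (mul_eq_zero.1 horth).resolve_right hY.ne'⟩
    · rw [h, Int.cast_zero, zero_mul, add_zero] at horth
      exact ⟨by exact_mod_cast (mul_eq_zero.1 horth).resolve_right hX.ne', h⟩
  rcases mul_eq_zero.1 h0.1 with h00 | h10
  -- Here γ exchanges the rows up to sign, so |B| < |D| would hold together with |D| < |B|.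
  · exfalso
    rw [h00, zero_mul, zero_sub] at hd
    have h11 : γ 1 1 = 0 := by
      rcases mul_eq_zero.1 h0.2 with h | h
      · rw [h] at hd; simp at hd
      · exact h
    have e01 : |((γ 0 1 : ℤ) : ℝ)| = 1 := by
      have : IsUnit (γ 0 1) := IsUnit.of_mul_eq_one (-γ 1 0) (by linarith)
      rcases Int.isUnit_iff.1 this with h | h <;> rw [h] <;> simp
    have e10 : |((γ 1 0 : ℤ) : ℝ)| = 1 := by
      have : IsUnit (γ 1 0) := IsUnit.of_mul_eq_one (-γ 0 1) (by linarith)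
      rcases Int.isUnit_iff.1 this with h | h <;> rw [h] <;> simp
    rw [h00, h11] at h4'
    simp only [Int.cast_zero, zero_mul, zero_add, add_zero, abs_mul, e01, e10, one_mul] at h4'
    linarith
  · rw [h10, mul_zero, sub_zero] at hd
    have h01 : γ 0 1 = 0 := by
      rcases mul_eq_zero.1 h0.2 with h | h
      · exact h
      · rw [h] at hd; simp at hd
    rcases Int.mul_eq_one_iff_eq_one_or_neg_one.1 hd with ⟨e0, e1⟩ | ⟨e0, e1⟩
    · left; ext i j; fin_cases i <;> fin_cases j <;> simp [h01, h10, e0, e1]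
    · right; ext i j; fin_cases i <;> fin_cases j <;> simp [h01, h10, e0, e1]

theorem eq_one_of_eq_one_or_neg_one {g : SL(2, ℝ)} {γ : SL(2, ℤ)} (h : γ = 1 ∨ γ = -1)
    (hg : 0 < g 1 1) (hγ : 0 < (toReal γ * g) 1 1) : γ = 1 := by
  rcases h with h | h
  · exact h
  · rw [h, toReal_neg, toReal_one, neg_one_mul, neg_apply] at hγ
    linarith

/-! ### The fundamental domain given by column sizes -/

/-- The elements of `SL₂(ℝ)` whose lattice basis is normalised by the size of its second column. -/
def columnDomain : Set SL(2, ℝ) :=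
  {g | IsGeneric g ∧ IsReduced g ∧ |g 0 1| ≤ 1 ∧ 1 < g 1 1}

theorem exists_mem_columnDomain {g : SL(2, ℝ)} (hg : IsGeneric g) :
    ∃ γ, toReal γ * g ∈ columnDomain := by
  obtain ⟨γ, b, d, ⟨ε, a, c, h, hc, hb⟩, hb1, hd1⟩ := hg.1.exists_normalized
  exact ⟨γ, hg.int_mul γ, h.isReduced hc hb, by rwa [h.abs01], by rwa [h.h11]⟩

theorem le_abs_add_of_one_le_mul {M N : ℤ} {b d : ℝ} (hb : 0 < b) (hd : 0 < d) (h : 1 ≤ M * N) :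
    b + d ≤ |M * b + N * d| := by
  rcases mul_pos_iff.1 (by omega : 0 < M * N) with ⟨h1, h2⟩ | ⟨h1, h2⟩
  · have h1' : (1 : ℝ) ≤ M := by exact_mod_cast h1
    have h2' : (1 : ℝ) ≤ N := by exact_mod_cast h2
    exact le_trans (by nlinarith) (le_abs_self _)
  · have h1' : (M : ℝ) ≤ -1 := by exact_mod_cast (by omega : M ≤ -1)
    have h2' : (N : ℝ) ≤ -1 := by exact_mod_cast (by omega : N ≤ -1)
    exact le_trans (by nlinarith) (neg_le_abs _)

theorem le_abs_sub_of_mul_le {M N : ℤ} {a c : ℝ} (ha : 0 < a) (hc : 0 < c) (h : M * N ≤ -1) :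
    a + c ≤ |M * a - N * c| := by
  have := le_abs_add_of_one_le_mul (M := M) (N := -N) ha hc (by linarith [mul_neg M N])
  push_cast at this
  rwa [neg_mul, ← sub_eq_add_neg] at this

/-- A lattice vector `m v₁ + n v₂` whose second coordinate is at most `1`. -/
theorem HasShape.eq_zero_or_le {g : SL(2, ℝ)} {ε : ℤ} {a b c d : ℝ} (h : HasShape g ε a b c d)
    (hd : 1 < d) {m n : ℤ} (hy : |m * g 0 1 + n * g 1 1| ≤ 1) :
    n = 0 ∨ a + c ≤ |m * g 0 0 + n * g 1 0| := by
  by_cases hn : n = 0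
  · exact Or.inl hn
  right
  have hs := h.sqR
  have ex : |m * g 0 0 + n * g 1 0| = |((m * ε : ℤ) : ℝ) * a - n * c| := by
    rw [h.h00, h.h10, ← one_mul |(_ : ℝ) * a + _|, ← h.abs_eps, ← abs_mul]
    congr 1; push_cast; linear_combination -n * c * hs
  have ey : |m * g 0 1 + n * g 1 1| = |((m * ε : ℤ) : ℝ) * b + n * d| := by
    rw [h.h01, h.h11]
    congr 1; push_cast; ring
  rw [ey] at hy
  rw [ex]
  rcases lt_trichotomy (m * ε * n) 0 with h1 | h1 | h1
  · exact le_abs_sub_of_mul_le h.a_pos h.c_pos (by omega)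
  · have h2 : m * ε = 0 := (mul_eq_zero.1 h1).resolve_right hn
    rw [h2] at hy
    have h3 : 1 ≤ |(n : ℝ)| := by exact_mod_cast Int.one_le_abs hn
    rw [Int.cast_zero, zero_mul, zero_add, abs_mul, abs_of_pos h.d_pos] at hy
    nlinarith
  · have := le_abs_add_of_one_le_mul h.b_pos h.d_pos (by omega : 1 ≤ m * ε * n)
    linarith [h.b_pos]

/-- By `HasShape.eq_zero_or_le`, a lattice vector with second coordinate at most 1 is a multiple of
the first basis vector or has first coordinate at least a + c. Applied to each basis in terms of the
other, this makes the first vectors agree up to sign; positivity of a and a' fixes the sign. -/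
theorem eq_one_of_mem_columnDomain {g : SL(2, ℝ)} {γ : SL(2, ℤ)} (hg : g ∈ columnDomain)
    (hγ : toReal γ * g ∈ columnDomain) : γ = 1 := by
  obtain ⟨-, hr, hb, hd⟩ := hg
  obtain ⟨-, hr', hb', hd'⟩ := hγ
  obtain ⟨ε, a, b, c, d, h, hca, hbd⟩ := hr.exists_hasShape (by linarith)
  obtain ⟨ε', a', b', c', d', h', hca', hbd'⟩ := hr'.exists_hasShape (by linarith)
  have hdet := int_det γ
  have hdetR : (γ 0 0 : ℝ) * γ 1 1 - γ 0 1 * γ 1 0 = 1 := by exact_mod_cast hdet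
  have e := fun i j => toReal_mul_apply γ g i j
  rw [h.h11] at hd
  rw [h'.h11] at hd'
  have hn : γ 0 1 = 0 := by
    have h1 := h.eq_zero_or_le hd (m := γ 0 0) (n := γ 0 1) (by rw [← e]; exact hb')
    rw [← e, h'.h00, abs_of_pos h'.a_pos] at h1
    have i0 : ∀ j, ((γ 1 1 : ℤ) : ℝ) * (toReal γ * g) 0 j + ((-γ 0 1 : ℤ) : ℝ) *
        (toReal γ * g) 1 j = g 0 j := by
      intro j
      rw [e, e]; push_cast; linear_combination g 0 j * hdetR
    have h2 := h'.eq_zero_or_le hd' (m := γ 1 1) (n := -γ 0 1) (by rw [i0]; exact hb)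
    rw [i0, h.h00, abs_of_pos h.a_pos] at h2
    rcases h1 with h1 | h1
    · exact h1
    rcases h2 with h2 | h2
    · omega
    · linarith [h.c_pos, h'.c_pos]
  rw [hn, zero_mul, sub_zero] at hdet
  have hm : γ 0 0 = 1 ∧ γ 1 1 = 1 := by
    rcases Int.mul_eq_one_iff_eq_one_or_neg_one.1 hdet with h1 | h1
    · exact h1
    · exfalso
      have := e 0 0
      rw [h'.h00, h.h00, hn, h1.1] at this
      push_cast at this
      linarith [h.a_pos, h'.a_pos]
  have ha : a' = a := by
    have := e 0 0
    rw [h'.h00, h.h00, hn, hm.1] at this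
    push_cast at this; linarith
  have hεb : (ε' : ℝ) * b' = ε * b := by
    have := e 0 1
    rw [h'.h01, h.h01, hn, hm.1] at this
    push_cast at this; linarith
  have hc' : |γ 1 0 * a - ε * c| = c' := by
    have := e 1 0
    rw [h.h00, h.h10, hm.2] at this
    rw [← h'.abs10, this]; congr 1; push_cast; ring
  have hc'' : |γ 1 0 * a' + ε' * c'| = c := by
    have := e 1 0
    rw [h.h00, h.h10, h'.h10, hm.2] at this
    rw [← h.abs10, h.h10, ha, ← abs_neg]; congr 1; push_cast at this; linarith
  have hε : ε' = ε := by
    have h1 := h.b_pos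
    have h2 := h'.b_pos
    rcases mul_self_eq_one_iff.1 h.sq with h3 | h3 <;>
      rcases mul_self_eq_one_iff.1 h'.sq with h4 | h4 <;> rw [h3, h4] <;> rw [h3, h4] at hεb <;>
      push_cast at hεb <;> first | rfl | linarith
  -- Otherwise, according to the sign of γ₁₀ε, either a + c ≤ c' or a' + c' ≤ c, against c' ≤ a' = a
  -- or c ≤ a = a'.
  have hk : γ 1 0 = 0 := by
    by_contra hk
    rcases lt_or_gt_of_ne (mul_ne_zero hk (left_ne_zero_of_mul_eq_one h.sq)) with hlt | hgt
    · have := le_abs_sub_of_mul_le h.a_pos h.c_pos (by omega : γ 1 0 * ε ≤ -1)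
      linarith [h.c_pos]
    · have := le_abs_sub_of_mul_le (M := γ 1 0) (N := -ε) h'.a_pos h'.c_pos
        (by linarith [mul_neg (γ 1 0) ε])
      rw [← hε] at this
      push_cast at this
      rw [neg_mul, sub_neg_eq_add, hc''] at this
      linarith [h'.c_pos]
  ext i j
  fin_cases i <;> fin_cases j <;> simp [hn, hm, hk]

/-! ### The fundamental domain given by the last visit -/

/-- The elements whose last visit in the past to the translates of `C` is to `C` itself. -/
def visitDomain : Set SL(2, ℝ) :=
  {g | IsGeneric g ∧ IsReduced g ∧ 0 < g 1 1 ∧ crossTime g < 0 ∧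
    ∀ γ, IsReduced (toReal γ * g) → crossTime (toReal γ * g) ≤ crossTime g ∨
      0 ≤ crossTime (toReal γ * g)}

theorem IsReduced.crossTime_mem {g : SL(2, ℝ)} {γ : SL(2, ℤ)} {T : ℝ}
    (h : IsReduced (toReal γ * g)) (hT : |crossTime (toReal γ * g)| ≤ T) :
    γ ∈ {γ : SL(2, ℤ) | ∃ t, |t| ≤ T ∧ toReal γ * g * a t ∈ ASO2} :=
  ⟨_, hT, (h.mul_a_mem_ASO2_iff _).2 rfl⟩

/-- One step back from a basis with b ≤ 1 < d, both second-column entries exceed 1. The determinant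
identity then makes both first-column entries less than 1, so the crossing lies in the past. -/
theorem NoAxisVector.exists_crossTime_neg {g : SL(2, ℝ)} (hg : NoAxisVector g) :
    ∃ γ, IsReduced (toReal γ * g) ∧ crossTime (toReal γ * g) < 0 := by
  obtain ⟨γ, b, d, h, hb, hd⟩ := hg.exists_normalized
  obtain ⟨δ, d', ⟨ε, a, c, h', hca, hbd⟩, -⟩ := h.backward (hg.int_mul γ)
  rw [← mul_assoc, ← toReal_mul] at h'
  have hr := h'.isReduced hca hbd
  refine ⟨δ * γ, hr, ?_⟩
  rw [crossTime]
  refine div_neg_of_neg_of_pos (Real.log_neg hr.quot_pos ?_) two_pos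
  have hdet := h'.det
  have e : -((toReal (δ * γ) * g) 0 0 * (toReal (δ * γ) * g) 1 0) /
      ((toReal (δ * γ) * g) 0 1 * (toReal (δ * γ) * g) 1 1) = a * c / (d * d') := by
    have h1 := h'.d_pos.ne'
    have h2 := h'.b_pos.ne'
    have hε : (ε : ℝ) ≠ 0 := left_ne_zero_of_mul_eq_one h'.sqR
    rw [h'.h00, h'.h01, h'.h10, h'.h11]; field_simp
  have ha := h'.a_pos
  have hc := h'.c_pos
  rw [e, div_lt_one (by nlinarith)]
  have : a < 1 := by nlinarith
  nlinarith

/-- A past visit exists, and only finitely many lie between it and time 0, so there is a last one.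
The sign of γ is then chosen to make D positive. -/
theorem exists_mem_visitDomain {g : SL(2, ℝ)} (hg : IsGeneric g) :
    ∃ γ, toReal γ * g ∈ visitDomain := by
  obtain ⟨γ₀, h₀, ht₀⟩ := hg.1.exists_crossTime_neg
  set T := crossTime (toReal γ₀ * g) with hT
  set S : Set SL(2, ℤ) := {γ | IsReduced (toReal γ * g) ∧ T ≤ crossTime (toReal γ * g) ∧
    crossTime (toReal γ * g) < 0}
  have hS : S.Finite := (finite_crossings g (-T)).subset fun γ hγ =>
    hγ.1.crossTime_mem (abs_le.2 ⟨by linarith [hγ.2.1], by linarith [hγ.2.2]⟩)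
  obtain ⟨γ, hγ, hmax⟩ := Set.exists_max_image S (fun γ => crossTime (toReal γ * g)) hS
    ⟨γ₀, h₀, le_rfl, ht₀⟩
  have key : ∀ δ, IsReduced (toReal δ * g) → crossTime (toReal δ * g) ≤ crossTime (toReal γ * g) ∨
      0 ≤ crossTime (toReal δ * g) := by
    intro δ hδ
    rcases le_or_gt 0 (crossTime (toReal δ * g)) with h | h
    · exact Or.inr h
    rcases le_or_gt T (crossTime (toReal δ * g)) with h' | h'
    · exact Or.inl (hmax δ ⟨hδ, h', h⟩)
    · exact Or.inl (h'.le.trans hγ.2.1)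
  have hne : (toReal γ * g) 1 1 ≠ 0 := (hg.1.int_mul γ).ne_zero 1 1
  rcases lt_or_gt_of_ne hne with h | h
  · refine ⟨-γ, hg.int_mul _, ?_, ?_, ?_, ?_⟩
    · rw [toReal_neg, neg_mul, isReduced_neg]; exact hγ.1
    · rw [toReal_neg, neg_mul, neg_apply]; linarith
    · rw [toReal_neg, neg_mul, crossTime_neg]; exact hγ.2.2
    · intro δ hδ
      rw [← mul_assoc, ← toReal_mul] at hδ ⊢
      rw [toReal_neg γ, neg_mul (toReal γ), crossTime_neg]
      exact key _ hδ
  · refine ⟨γ, hg.int_mul _, hγ.1, h, hγ.2.2, fun δ hδ => ?_⟩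
    rw [← mul_assoc, ← toReal_mul] at hδ ⊢
    exact key _ hδ

/-- Maximality in both directions makes the two crossing times equal, so γ maps a point of C into C
and is ±1. -/
theorem eq_one_of_mem_visitDomain {g : SL(2, ℝ)} {γ : SL(2, ℤ)} (hg : g ∈ visitDomain)
    (hγ : toReal γ * g ∈ visitDomain) : γ = 1 := by
  obtain ⟨-, h1, h2, h3, h4⟩ := hg
  obtain ⟨-, h1', h2', h3', h4'⟩ := hγ
  have e1 := (h4 γ h1').resolve_right (not_le.2 h3')
  have e2 := h4' γ⁻¹
  rw [← mul_assoc, ← toReal_mul, inv_mul_cancel, toReal_one, one_mul] at e2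
  have e : crossTime (toReal γ * g) = crossTime g :=
    le_antisymm e1 ((e2 h1).resolve_right (not_le.2 h3))
  refine eq_one_of_eq_one_or_neg_one (eq_one_or_neg_one_of_mem_C h1.mul_a_mem_C ?_) h2 h2'
  have := h1'.mul_a_mem_C
  rwa [e, mul_assoc] at this

/-! ### Haar measure on SL₂(ℝ) -/

instance : MeasurableSpace SL(2, ℝ) := borel _

instance : BorelSpace SL(2, ℝ) := ⟨rfl⟩

theorem continuous_entry (i j : Fin 2) : Continuous fun g : SL(2, ℝ) => g i j :=
  (continuous_apply j).comp ((continuous_apply i).comp continuous_subtype_val)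

theorem isClosedEmbedding_entries :
    Topology.IsClosedEmbedding fun (g : SL(2, ℝ)) (i j : Fin 2) => g i j := by
  have h : IsClosed {A : Matrix (Fin 2) (Fin 2) ℝ | A.det = 1} :=
    isClosed_eq (Continuous.matrix_det continuous_id) continuous_const
  exact h.isClosedEmbedding_subtypeVal

theorem measurable_entry (i j : Fin 2) : Measurable fun g : SL(2, ℝ) => g i j :=
  (continuous_entry i j).measurable

theorem measurable_of_entries {X : Type*} [MeasurableSpace X] {f : X → SL(2, ℝ)}
    (hf : ∀ i j, Measurable fun x => f x i j) : Measurable f := by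
  rw [← isClosedEmbedding_entries.measurableEmbedding.measurable_comp_iff]
  exact measurable_pi_lambda _ fun i => measurable_pi_lambda _ fun j => hf i j

instance : SecondCountableTopology SL(2, ℝ) :=
  isClosedEmbedding_entries.isEmbedding.secondCountableTopology

instance : Countable SL(2, ℤ) :=
  Function.Injective.countable (f := fun (γ : SL(2, ℤ)) (i j : Fin 2) => γ i j)
    fun γ δ h => by ext i j; exact congrFun (congrFun h i) j

instance : Countable Γ :=
  Function.Surjective.countable (f := fun γ : SL(2, ℤ) => (⟨toReal γ, toReal_mem γ⟩ : Γ))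
    fun ⟨h, hh⟩ => by obtain ⟨γ, rfl⟩ := exists_toReal_eq hh; exact ⟨γ, rfl⟩

/-- The element of `SL₂(ℝ)` with the given entries. -/
def ofEntries (m n k l : ℝ) (h : m * l - n * k = 1) : SL(2, ℝ) :=
  ⟨!![m, n; k, l], by rw [Matrix.det_fin_two_of, h]⟩

/-- The element with bottom row `(C, D)` and endpoint `ω = y`, where `w = ((D, C), y)`. -/
def ofCoord (w : (ℝ × ℝ) × ℝ) : SL(2, ℝ) :=
  if h : w.1.1 ≠ 0 then
    ofEntries (1 / w.1.1 + w.2 * w.1.2) (w.2 * w.1.1) w.1.2 w.1.1 (by field_simp; ring)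
  else 1

theorem ofCoord_apply {w : (ℝ × ℝ) × ℝ} (h : w.1.1 ≠ 0) :
    ofCoord w 0 0 = 1 / w.1.1 + w.2 * w.1.2 ∧ ofCoord w 0 1 = w.2 * w.1.1 ∧
      ofCoord w 1 0 = w.1.2 ∧ ofCoord w 1 1 = w.1.1 := by
  rw [ofCoord, dif_pos h]; simp [ofEntries]

theorem ext_entries {g h : SL(2, ℝ)} (h00 : g 0 0 = h 0 0) (h01 : g 0 1 = h 0 1)
    (h10 : g 1 0 = h 1 0) (h11 : g 1 1 = h 1 1) : g = h := by
  ext i j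
  fin_cases i <;> fin_cases j <;> assumption

theorem measurable_ofCoord : Measurable ofCoord := by
  refine measurable_of_entries fun i j => ?_
  have hs : MeasurableSet {w : (ℝ × ℝ) × ℝ | w.1.1 ≠ 0} :=
    (measurableSet_singleton (0 : ℝ)).compl.preimage (by fun_prop)
  have e : (fun w => ofCoord w i j) = fun w : (ℝ × ℝ) × ℝ => if w.1.1 ≠ 0 then
      (!![1 / w.1.1 + w.2 * w.1.2, w.2 * w.1.1; w.1.2, w.1.1] : Matrix (Fin 2) (Fin 2) ℝ) i j
      else (1 : Matrix (Fin 2) (Fin 2) ℝ) i j := by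
    funext w
    by_cases h : w.1.1 ≠ 0
    · rw [ofCoord, dif_pos h, if_pos h]; rfl
    · rw [ofCoord, dif_neg h, if_neg h]; rfl
  rw [e]
  refine Measurable.ite hs ?_ measurable_const
  fin_cases i <;> fin_cases j <;> simp <;> fun_prop

/-- The Haar measure of `SL₂(ℝ)`, suitably normalised. -/
def haar : Measure SL(2, ℝ) := (2 : ℝ≥0∞) • (volume : Measure ((ℝ × ℝ) × ℝ)).map ofCoord

instance : SFinite haar := by unfold haar; infer_instance

theorem map_prod_linear {m n k l : ℝ} (h : |m * l - n * k| = 1) :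
    MeasurePreserving (fun v : ℝ × ℝ => (m * v.1 + n * v.2, k * v.1 + l * v.2)) := by
  set L := Matrix.toLin (Module.Basis.finTwoProd ℝ) (Module.Basis.finTwoProd ℝ) !![m, n; k, l]
  have hL : (fun v : ℝ × ℝ => (m * v.1 + n * v.2, k * v.1 + l * v.2)) = L := by
    funext v; exact (Matrix.toLin_finTwoProd_apply m n k l v).symm
  have hdet : LinearMap.det L = m * l - n * k := by
    rw [LinearMap.det_toLin, Matrix.det_fin_two_of]
  refine ⟨by fun_prop, ?_⟩
  rw [hL, Measure.map_linearMap_addHaar_eq_smul_addHaar volume, hdet, abs_inv, h]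
  · simp
  · rw [hdet]; intro h0; rw [h0] at h; simp at h

theorem ae_fst_fst_ne_zero : ∀ᵐ w : (ℝ × ℝ) × ℝ, w.1.1 ≠ 0 := by
  have h1 : ∀ᵐ x : ℝ, x ≠ 0 := by simp [ae_iff]
  have h2 : ∀ᵐ v : ℝ × ℝ, v.1 ≠ 0 := Measure.quasiMeasurePreserving_fst.ae h1
  exact Measure.quasiMeasurePreserving_fst.ae h2

theorem map_haar_eq {F : SL(2, ℝ) → SL(2, ℝ)} (hF : Measurable F)
    {R : (ℝ × ℝ) × ℝ → (ℝ × ℝ) × ℝ} (hR : MeasurePreserving R)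
    (h : ∀ᵐ w, F (ofCoord w) = ofCoord (R w)) : haar.map F = haar := by
  rw [haar, Measure.map_smul, Measure.map_map hF measurable_ofCoord]
  congr 1
  rw [Measure.map_congr (f := F ∘ ofCoord) (g := ofCoord ∘ R) h, ← Measure.map_map measurable_ofCoord hR.measurable,
    hR.map_eq]

theorem measurable_mul_right (h : SL(2, ℝ)) : Measurable fun g : SL(2, ℝ) => g * h :=
  (continuous_mul_const h).measurable

/-- Right multiplication acts on (D, C) linearly with determinant 1 and translates y by an amount
depending only on (D, C). Such a skew product preserves Lebesgue measure. -/
theorem map_mul_right_haar (h : SL(2, ℝ)) : haar.map (fun g => g * h) = haar := by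
  have hdet := det_eq h
  have hbase := map_prod_linear (m := h 1 1) (n := h 0 1) (k := h 1 0) (l := h 0 0) (by
    rw [show h 1 1 * h 0 0 - h 0 1 * h 1 0 = 1 by linear_combination hdet, abs_one])
  have hR : MeasurePreserving (fun w : (ℝ × ℝ) × ℝ =>
      ((h 1 1 * w.1.1 + h 0 1 * w.1.2, h 1 0 * w.1.1 + h 0 0 * w.1.2),
        w.2 + h 0 1 / (w.1.1 * (h 1 1 * w.1.1 + h 0 1 * w.1.2)))) :=
    hbase.skew_product (μc := volume) (μd := volume)
      (g := fun v y => y + h 0 1 / (v.1 * (h 1 1 * v.1 + h 0 1 * v.2)))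
      (by unfold Function.uncurry; fun_prop)
      (Filter.Eventually.of_forall fun v => (measurePreserving_add_right volume _).map_eq)
  refine map_haar_eq (measurable_mul_right h) hR ?_
  filter_upwards [ae_fst_fst_ne_zero, hR.quasiMeasurePreserving.ae ae_fst_fst_ne_zero]
    with w hw (hw' : h 1 1 * w.1.1 + h 0 1 * w.1.2 ≠ 0)
  obtain ⟨a00, a01, a10, a11⟩ := ofCoord_apply hw
  obtain ⟨b00, b01, b10, b11⟩ := ofCoord_apply (w := ((h 1 1 * w.1.1 + h 0 1 * w.1.2,
    h 1 0 * w.1.1 + h 0 0 * w.1.2), w.2 + h 0 1 / (w.1.1 * (h 1 1 * w.1.1 + h 0 1 * w.1.2)))) hw'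
  obtain ⟨E, hE⟩ : ∃ E, E = h 1 1 * w.1.1 + h 0 1 * w.1.2 := ⟨_, rfl⟩
  have hm : ∀ i j, (ofCoord w * h) i j = ofCoord w i 0 * h 0 j + ofCoord w i 1 * h 1 j := by
    intro i j
    rw [Matrix.SpecialLinearGroup.coe_mul, Matrix.mul_apply, Fin.sum_univ_two]
  refine ext_entries ?_ ?_ ?_ ?_
  · rw [hm, a00, a01, b00]
    simp only
    rw [← hE] at hw' ⊢
    field_simp
    linear_combination h 0 0 * hE + w.1.1 * hdet
  · rw [hm, a00, a01, b01]
    simp only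
    rw [← hE] at hw' ⊢
    field_simp
    linear_combination -w.1.1 * w.2 * hE
  · rw [hm, a10, a11, b10]; simp only; ring
  · rw [hm, a10, a11, b11]; simp only; ring

theorem measurable_transpose : Measurable fun g : SL(2, ℝ) => g.transpose :=
  measurable_of_entries fun i j => measurable_entry j i

/-- In coordinates, (D, C, y) goes to (D, Dy, C/D); for fixed D ≠ 0 this is linear of determinant -1
in (C, y). It turns right invariance into left invariance. -/
theorem map_transpose_haar : haar.map (fun g => g.transpose) = haar := by
  have hT : MeasurePreserving (fun v : ℝ × (ℝ × ℝ) => (v.1, (v.1 * v.2.2, v.1⁻¹ * v.2.1))) := by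
    refine (MeasurePreserving.id volume).skew_product (μc := volume) (μd := volume)
      (g := fun (D : ℝ) (v : ℝ × ℝ) => (D * v.2, D⁻¹ * v.1)) (by unfold Function.uncurry; fun_prop) ?_
    filter_upwards [(by simp [ae_iff] : ∀ᵐ x : ℝ, x ≠ 0)] with D hD
    have := map_prod_linear (m := 0) (n := D) (k := D⁻¹) (l := 0) (by
      rw [mul_inv_cancel₀ hD]; simp)
    simpa using this.map_eq
  have hR : MeasurePreserving (fun w : (ℝ × ℝ) × ℝ => ((w.1.1, w.1.1 * w.2), w.1.1⁻¹ * w.1.2)) :=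
    (volume_preserving_prodAssoc.symm _).comp (hT.comp volume_preserving_prodAssoc)
  refine map_haar_eq measurable_transpose hR ?_
  filter_upwards [ae_fst_fst_ne_zero] with w hw
  obtain ⟨a00, a01, a10, a11⟩ := ofCoord_apply hw
  obtain ⟨b00, b01, b10, b11⟩ := ofCoord_apply
    (w := ((w.1.1, w.1.1 * w.2), w.1.1⁻¹ * w.1.2)) hw
  have ht : ∀ i j, (ofCoord w).transpose i j = ofCoord w j i := fun i j => rfl
  refine ext_entries ?_ ?_ ?_ ?_
  · rw [ht, a00, b00]; simp only; field_simp
  · rw [ht, a10, b01]; simp only; field_simp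
  · rw [ht, a01, b10]; simp only; ring
  · rw [ht, a11, b11]

theorem map_mul_left_haar (h : SL(2, ℝ)) : haar.map (fun g => h * g) = haar := by
  have e : (fun g => h * g) = (fun g : SL(2, ℝ) => g.transpose) ∘ (fun g => g * h.transpose) ∘
      (fun g : SL(2, ℝ) => g.transpose) := by
    funext g
    apply Subtype.ext
    simp [Matrix.SpecialLinearGroup.coe_transpose, Matrix.transpose_mul]
  rw [e, ← Measure.map_map measurable_transpose
    ((measurable_mul_right _).comp measurable_transpose),
    ← Measure.map_map (measurable_mul_right _) measurable_transpose, map_transpose_haar,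
    map_mul_right_haar, map_transpose_haar]

theorem measurePreserving_mul_right (h : SL(2, ℝ)) :
    MeasurePreserving (fun g => g * h) haar haar :=
  ⟨measurable_mul_right h, map_mul_right_haar h⟩

theorem measurePreserving_mul_left (h : SL(2, ℝ)) :
    MeasurePreserving (fun g => h * g) haar haar :=
  ⟨(continuous_const_mul h).measurable, map_mul_left_haar h⟩

theorem measurableSet_ASO2 : MeasurableSet ASO2 := by
  have : ASO2 = {g | g 0 0 * g 1 0 + g 0 1 * g 1 1 = 0} := Set.ext mem_ASO2_iff
  rw [this]
  exact measurableSet_eq_fun (by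
    have := measurable_entry
    fun_prop) measurable_const

theorem haar_eq_zero {S : Set SL(2, ℝ)} (hS : MeasurableSet S)
    (h : ∀ D C : ℝ, D ≠ 0 → C ≠ 0 → {y : ℝ | ofCoord ((D, C), y) ∈ S}.Subsingleton) :
    haar S = 0 := by
  rw [haar, Measure.smul_apply, Measure.map_apply measurable_ofCoord hS,
    (_ : volume (ofCoord ⁻¹' S) = 0), smul_zero]
  refine (Measure.measure_prod_null (measurable_ofCoord hS)).2 ?_
  have h1 : ∀ᵐ x : ℝ, x ≠ 0 := by simp [ae_iff]
  filter_upwards [(Measure.quasiMeasurePreserving_fst (μ := volume) (ν := volume)).ae h1,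
    (Measure.quasiMeasurePreserving_snd (μ := volume) (ν := volume)).ae h1] with v hv hv'
  exact (h v.1 v.2 hv hv').measure_zero _

/-- There are countably many exceptional conditions. For fixed nonzero C and D, a nontrivial axis
condition or membership in A · SO₂ is affine in y and has at most one solution. Left invariance
handles the translates. -/
theorem ae_isGeneric : ∀ᵐ g ∂haar, IsGeneric g := by
  refine Filter.Eventually.and ?_ ?_
  · refine ae_all_iff.2 fun j => ae_all_iff.2 fun m => ae_all_iff.2 fun n => ?_
    by_cases hmn : m = 0 ∧ n = 0
    · exact Filter.Eventually.of_forall fun g _ => hmn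
    suffices h : haar {g | (m : ℝ) * g 0 j + n * g 1 j = 0} = 0 by
      refine measure_mono_null (fun g hg => ?_) h
      by_contra hcon
      exact hg fun h0 => absurd h0 hcon
    refine haar_eq_zero (measurableSet_eq_fun (by
      have := measurable_entry
      fun_prop) measurable_const) fun D C hD hC y hy z hz => ?_
    obtain ⟨a00, a01, a10, a11⟩ := ofCoord_apply (w := ((D, C), y)) hD
    obtain ⟨b00, b01, b10, b11⟩ := ofCoord_apply (w := ((D, C), z)) hD
    simp only [Set.mem_ofPred_eq] at hy hz
    have hm : (m : ℝ) ≠ 0 := by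
      intro hm
      have hn : (n : ℝ) ≠ 0 := fun hn => hmn ⟨by exact_mod_cast hm, by exact_mod_cast hn⟩
      fin_cases j
      · simp [hm, a10, hn, hC] at hy
      · simp [hm, a11, hn, hD] at hy
    fin_cases j
    · simp only [Fin.zero_eta, a00, b00, a10, b10] at hy hz
      have : m * C * (y - z) = 0 := by linear_combination hy - hz
      simpa [hm, hC, sub_eq_zero] using this
    · simp only [Fin.mk_one, a01, b01, a11, b11] at hy hz
      have : m * D * (y - z) = 0 := by linear_combination hy - hz
      simpa [hm, hD, sub_eq_zero] using this
  · refine ae_all_iff.2 fun γ => ?_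
    refine (measurePreserving_mul_left (toReal γ)).quasiMeasurePreserving.ae
      (p := fun g => g ∉ ASO2) ?_
    have h : haar ASO2 = 0 := by
      refine haar_eq_zero measurableSet_ASO2 fun D C hD hC y hy z hz => ?_
      obtain ⟨a00, a01, a10, a11⟩ := ofCoord_apply (w := ((D, C), y)) hD
      obtain ⟨b00, b01, b10, b11⟩ := ofCoord_apply (w := ((D, C), z)) hD
      simp only [Set.mem_ofPred_eq, mem_ASO2_iff, a00, b00, a10, b10, a01, b01, a11, b11] at hy hz
      have h1 : (C ^ 2 + D ^ 2) * (y - z) = 0 := by linear_combination hy - hz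
      have h2 : C ^ 2 + D ^ 2 ≠ 0 := by positivity
      linarith [(mul_eq_zero.1 h1).resolve_left h2]
    simpa [ae_iff] using h

/-! ### Haar measure in the coordinates of the cross-section -/

instance : MeasurableSingletonClass ℤˣ where
  measurableSet_singleton u := by
    have : {u} = ((↑) : ℤˣ → ℤ) ⁻¹' {(u : ℤ)} := by ext v; exact Units.ext_iff
    rw [this]
    exact (comap_measurable _) (measurableSet_singleton _)

theorem measurable_sign : Measurable fun p : ℝ × ℝ × ℤˣ => ((p.2.2 : ℤ) : ℝ) :=
  (Measurable.of_discrete (f := fun ε : ℤˣ => ((ε : ℤ) : ℝ))).comp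
    (measurable_snd.comp measurable_snd)

theorem endMat_mul_a_apply (p : ℝ × ℝ × ℤˣ) (s : ℝ) :
    (endMat p * a s) 0 0 = (1 - p.1 * p.2.1) * Real.exp (-s / 2) ∧
    (endMat p * a s) 0 1 = ((p.2.2 : ℤ) : ℝ) * p.1 * Real.exp (s / 2) ∧
    (endMat p * a s) 1 0 = -(((p.2.2 : ℤ) : ℝ) * p.2.1) * Real.exp (-s / 2) ∧
    (endMat p * a s) 1 1 = Real.exp (s / 2) := by
  refine ⟨?_, ?_, ?_, ?_⟩
  · rw [mul_a_zero]; simp [endMat]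
  · rw [mul_a_one]; simp [endMat]
  · rw [mul_a_zero]; simp [endMat]
  · rw [mul_a_one]; simp [endMat]

theorem measurable_endMat_mul_a :
    Measurable fun q : (ℝ × ℝ × ℤˣ) × ℝ => endMat q.1 * a q.2 := by
  have hs : Measurable fun q : (ℝ × ℝ × ℤˣ) × ℝ => ((q.1.2.2 : ℤ) : ℝ) :=
    measurable_sign.comp measurable_fst
  refine measurable_of_entries fun i j => ?_
  fin_cases i <;> fin_cases j <;> simp only [Fin.zero_eta, Fin.mk_one, endMat_mul_a_apply] <;>
    fun_prop

theorem endMat_mul_a_eq_ofCoord (y z s : ℝ) (ε : ℤˣ) :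
    endMat (y, z, ε) * a s = ofCoord ((Real.exp (s / 2),
      -(((ε : ℤ) : ℝ) * Real.exp (-s / 2)) * z), ((ε : ℤ) : ℝ) * y) := by
  obtain ⟨h00, h01, h10, h11⟩ := endMat_mul_a_apply (y, z, ε) s
  have hpos := (Real.exp_pos (s / 2)).ne'
  obtain ⟨b00, b01, b10, b11⟩ := ofCoord_apply (w := ((Real.exp (s / 2),
      -(((ε : ℤ) : ℝ) * Real.exp (-s / 2)) * z), ((ε : ℤ) : ℝ) * y)) hpos
  refine ext_entries ?_ ?_ ?_ ?_
  · rw [h00, b00]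
    have : 1 / Real.exp (s / 2) = Real.exp (-s / 2) := by
      rw [neg_div, Real.exp_neg, one_div]
    simp only [this]
    linear_combination y * z * Real.exp (-s / 2) * unit_sq ε
  · rw [h01, b01]
  · rw [h10, b10]; ring
  · rw [h11, b11]

theorem lintegral_comp_const_mul {c : ℝ} (hc : c ≠ 0) {f : ℝ → ℝ≥0∞} (hf : Measurable f) :
    ∫⁻ z, f (c * z) = ENNReal.ofReal |c⁻¹| * ∫⁻ z, f z := by
  have : ∫⁻ z, f z ∂(volume.map (c * ·)) = ∫⁻ z, f (c * z) :=
    lintegral_map hf (measurable_const_mul c)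
  rw [← this, Real.map_volume_mul_left hc, lintegral_smul_measure, smul_eq_mul]

theorem lintegral_eq_add_neg {f : ℝ → ℝ≥0∞} (hf : Measurable f) :
    ∫⁻ y, f y = (∫⁻ y in Set.Ioi 0, f y) + ∫⁻ y in Set.Ioi 0, f (-y) := by
  have h1 : ∫⁻ y in Set.Ioi (0 : ℝ), f (-y) = ∫⁻ y in Set.Iio 0, f y := by
    have := (Measure.measurePreserving_neg (volume : Measure ℝ)).setLIntegral_comp_preimage
      (measurableSet_Iio (a := (0 : ℝ))) hf
    rw [← this]
    congr 2
    ext y; simp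
  rw [h1, ← lintegral_add_compl f measurableSet_Ioi, Set.compl_Ioi]
  congr 1
  exact (setLIntegral_congr Iio_ae_eq_Iic).symm

/-- The substitution D = e^{s/2} has derivative e^{s/2}/2, which is the origin of the factor 2 in
`haar`. -/
theorem setLIntegral_Ioi_eq_exp (f : ℝ → ℝ≥0∞) :
    2 * ∫⁻ D in Set.Ioi (0 : ℝ), f D =
      ∫⁻ s, ENNReal.ofReal (Real.exp (s / 2)) * f (Real.exp (s / 2)) := by
  have him : (fun s : ℝ => Real.exp (s / 2)) '' Set.univ = Set.Ioi 0 := by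
    rw [Set.image_univ]
    ext x
    constructor
    · rintro ⟨s, rfl⟩; exact Real.exp_pos _
    · intro hx
      exact ⟨2 * Real.log x, by simp only; rw [mul_div_cancel_left₀ _ two_ne_zero, Real.exp_log hx]⟩
  have h := lintegral_image_eq_lintegral_abs_deriv_mul (s := Set.univ)
    (f := fun s : ℝ => Real.exp (s / 2)) (f' := fun s => Real.exp (s / 2) * (1 / 2))
    MeasurableSet.univ (fun s _ => (((hasDerivAt_id s).div_const 2).exp).hasDerivWithinAt)
    (fun s _ t _ h => by
      have := Real.exp_injective h
      linarith) f
  rw [him, Measure.restrict_univ] at h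
  rw [h, ← lintegral_const_mul' _ _ ENNReal.ofNat_ne_top]
  refine lintegral_congr fun s => ?_
  rw [← mul_assoc, abs_of_pos (by positivity)]
  congr 1
  rw [← ENNReal.ofReal_ofNat 2, ← ENNReal.ofReal_mul two_pos.le]
  congr 1; ring

theorem lintegral_haar_pos {f : SL(2, ℝ) → ℝ≥0∞} (hf : Measurable f) :
    ∫⁻ g in {g | 0 < g 1 1}, f g ∂haar =
      ∫⁻ y, 2 * ∫⁻ D in Set.Ioi (0 : ℝ), ∫⁻ C, f (ofCoord ((D, C), y)) := by
  have hm : MeasurableSet {g : SL(2, ℝ) | 0 < g 1 1} :=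
    measurableSet_lt measurable_const (measurable_entry 1 1)
  have hpre : ∀ᵐ w : (ℝ × ℝ) × ℝ,
      w ∈ ofCoord ⁻¹' {g | 0 < g 1 1} ↔ w ∈ (Set.Ioi (0 : ℝ) ×ˢ Set.univ) ×ˢ Set.univ := by
    filter_upwards [ae_fst_fst_ne_zero] with w hw
    simp [ofCoord_apply hw]
  have hF : Measurable fun w => f (ofCoord w) := hf.comp measurable_ofCoord
  rw [haar, Measure.restrict_smul, lintegral_smul_measure, setLIntegral_map hm hf
    measurable_ofCoord, setLIntegral_congr (Filter.eventuallyEq_set.2 hpre), Measure.volume_eq_prod,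
    ← Measure.prod_restrict, Measure.restrict_univ, lintegral_prod_symm _ hF.aemeasurable,
    smul_eq_mul, ← lintegral_const_mul' _ _ ENNReal.ofNat_ne_top]
  refine lintegral_congr fun y => ?_
  rw [Measure.volume_eq_prod, ← Measure.prod_restrict, Measure.restrict_univ, lintegral_prod]
  exact (hF.comp (by fun_prop)).aemeasurable

/-- The part `y > 0` of the coordinate space. -/
def coordMeasure : Measure ((ℝ × ℝ × ℤˣ) × ℝ) :=
  (lebY.prod volume).restrict {q | 0 < q.1.1}

theorem coordMeasure_eq : coordMeasure =
    ((volume.restrict (Set.Ioi (0 : ℝ))).prod (volume.prod Measure.count)).prod volume := by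
  have : {q : (ℝ × ℝ × ℤˣ) × ℝ | 0 < q.1.1} = (Set.Ioi 0 ×ˢ Set.univ) ×ˢ Set.univ := by
    ext q; simp
  rw [coordMeasure, lebY, this, ← Measure.prod_restrict, ← Measure.prod_restrict,
    Measure.restrict_univ, Measure.restrict_univ]

theorem lintegral_units (f : ℤˣ → ℝ≥0∞) : ∫⁻ ε, f ε ∂Measure.count = f 1 + f (-1) := by
  rw [lintegral_count, tsum_fintype]
  exact Finset.sum_pair (by decide)

/-- With D = e^{s/2}, the substitution C = -ε e^{-s/2} z produces exactly the Jacobian e^{s/2}, and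
the sum over ε unfolds y > 0 to the whole line. The shift τ is absorbed by translation invariance in
s: τ = 0 serves `columnDomain`, and `sectionShift` starts the clock on the cross-section. -/
theorem lintegral_coordMeasure {f : SL(2, ℝ) → ℝ≥0∞} (hf : Measurable f)
    {τ : ℝ × ℝ × ℤˣ → ℝ} (hτ : Measurable τ) :
    ∫⁻ q, f (endMat q.1 * a (τ q.1 + q.2)) ∂coordMeasure =
      ∫⁻ g in {g | 0 < g 1 1}, f g ∂haar := by
  have hF : Measurable fun w => f (ofCoord w) := hf.comp measurable_ofCoord
  have hE : Measurable fun q : (ℝ × ℝ × ℤˣ) × ℝ => f (endMat q.1 * a q.2) :=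
    hf.comp measurable_endMat_mul_a
  set K : ℝ → ℝ → ℝ≥0∞ := fun y D => ∫⁻ C, f (ofCoord ((D, C), y)) with hK
  have hKm : Measurable (Function.uncurry K) := by
    have : Measurable fun x : (ℝ × ℝ) × ℝ => f (ofCoord ((x.1.2, x.2), x.1.1)) :=
      hF.comp (by fun_prop)
    exact this.lintegral_prod_right'
  set H : ℝ → ℝ≥0∞ := fun y => ∫⁻ s, ENNReal.ofReal (Real.exp (s / 2)) * K y (Real.exp (s / 2))
    with hH
  have hHm : Measurable H := by
    have : Measurable fun x : ℝ × ℝ =>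
        ENNReal.ofReal (Real.exp (x.2 / 2)) * K x.1 (Real.exp (x.2 / 2)) := by
      refine Measurable.mul (by fun_prop) ?_
      exact hKm.comp (by fun_prop : Measurable fun x : ℝ × ℝ => (x.1, Real.exp (x.2 / 2)))
    exact this.lintegral_prod_right'
  have key : ∀ (y : ℝ) (ε : ℤˣ), ∫⁻ z, ∫⁻ s, f (endMat (y, z, ε) * a s) = H (((ε : ℤ) : ℝ) * y) := by
    intro y ε
    rw [lintegral_lintegral_swap]
    · refine lintegral_congr fun s => ?_
      have hne : -(((ε : ℤ) : ℝ) * Real.exp (-s / 2)) ≠ 0 :=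
        neg_ne_zero.2 (mul_ne_zero (left_ne_zero_of_mul_eq_one (unit_sq ε)) (Real.exp_pos _).ne')
      have habs : |(-(((ε : ℤ) : ℝ) * Real.exp (-s / 2)))⁻¹| = Real.exp (s / 2) := by
        have : |((ε : ℤ) : ℝ)| = 1 := by
          rcases Int.units_eq_one_or ε with h | h <;> simp [h]
        rw [abs_inv, abs_neg, abs_mul, this, one_mul, Real.abs_exp, neg_div, Real.exp_neg, inv_inv]
      simp only [endMat_mul_a_eq_ofCoord]
      have := lintegral_comp_const_mul hne
        (f := fun C => f (ofCoord ((Real.exp (s / 2), C), ((ε : ℤ) : ℝ) * y)))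
        (hF.comp (by fun_prop))
      rw [this, habs]
    · exact (hE.comp (by fun_prop : Measurable fun x : ℝ × ℝ => (((y, x.1, ε), x.2) :
        (ℝ × ℝ × ℤˣ) × ℝ))).aemeasurable
  rw [coordMeasure_eq, lintegral_prod]
  swap
  · exact (hE.comp (by fun_prop : Measurable fun q : (ℝ × ℝ × ℤˣ) × ℝ =>
      (q.1, τ q.1 + q.2))).aemeasurable
  have hshift : ∀ p : ℝ × ℝ × ℤˣ, ∫⁻ s, f (endMat p * a (τ p + s)) =
      ∫⁻ s, f (endMat p * a s) := fun p =>
    lintegral_add_left_eq_self (fun s => f (endMat p * a s)) (τ p)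
  simp only [hshift]
  have hm1 : Measurable fun p : ℝ × ℝ × ℤˣ => ∫⁻ s, f (endMat p * a s) := hE.lintegral_prod_right'
  rw [lintegral_prod _ hm1.aemeasurable, lintegral_haar_pos hf]
  calc ∫⁻ y in Set.Ioi (0 : ℝ), ∫⁻ v, (∫⁻ s, f (endMat (y, v) * a s)) ∂(volume.prod Measure.count)
      = ∫⁻ y in Set.Ioi (0 : ℝ), (H y + H (-y)) := by
        refine lintegral_congr fun y => ?_
        have hm2 : Measurable fun v : ℝ × ℤˣ => ∫⁻ s, f (endMat (y, v) * a s) :=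
          hm1.comp measurable_prodMk_left
        rw [lintegral_prod_symm _ hm2.aemeasurable, lintegral_units, key, key]
        simp
    _ = ∫⁻ y, H y := by
        rw [lintegral_add_left hHm, ← lintegral_eq_add_neg hHm]
    _ = _ := lintegral_congr fun y => (setLIntegral_Ioi_eq_exp _).symm

theorem map_coordMeasure {τ : ℝ × ℝ × ℤˣ → ℝ} (hτ : Measurable τ) :
    coordMeasure.map (fun q => endMat q.1 * a (τ q.1 + q.2)) = haar.restrict {g | 0 < g 1 1} := by
  have hm : Measurable fun q : (ℝ × ℝ × ℤˣ) × ℝ => endMat q.1 * a (τ q.1 + q.2) :=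
    measurable_endMat_mul_a.comp (by fun_prop : Measurable fun q : (ℝ × ℝ × ℤˣ) × ℝ =>
      (q.1, τ q.1 + q.2))
  refine Measure.ext_of_lintegral _ fun f hf => ?_
  rw [lintegral_map hf hm, lintegral_coordMeasure hf hτ]

/-! ### Measurability, and the two fundamental domains -/

theorem measurableSet_isGeneric : MeasurableSet {g | IsGeneric g} := by
  have := measurable_entry
  refine MeasurableSet.inter (s₁ := {g | NoAxisVector g})
    (s₂ := {g | ∀ γ, toReal γ * g ∉ ASO2}) ?_ ?_
  · simp only [NoAxisVector, Set.ofPred_forall]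
    refine MeasurableSet.iInter fun j => MeasurableSet.iInter fun m => MeasurableSet.iInter fun n =>
      ?_
    by_cases hmn : m = 0 ∧ n = 0
    · simp [hmn]
    · simp only [hmn, imp_false]
      exact (measurableSet_eq_fun (by fun_prop) measurable_const).compl
  · simp only [Set.ofPred_forall]
    exact MeasurableSet.iInter fun γ =>
      (measurePreserving_mul_left (toReal γ)).measurable measurableSet_ASO2.compl

theorem measurableSet_isReduced : MeasurableSet {g | IsReduced g} := by
  have := measurable_entry
  have habs : ∀ i j, Measurable fun g : SL(2, ℝ) => |g i j| := fun i j =>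
    continuous_abs.measurable.comp (this i j)
  exact (measurableSet_lt measurable_const ((this 0 0).mul (this 1 1))).inter
    ((measurableSet_lt ((this 0 1).mul (this 1 0)) measurable_const).inter
      ((measurableSet_le (habs 1 0) (habs 0 0)).inter (measurableSet_lt (habs 0 1) (habs 1 1))))

theorem measurable_crossTime : Measurable crossTime := by
  have := measurable_entry
  unfold crossTime
  fun_prop

theorem measurableSet_columnDomain : MeasurableSet columnDomain :=
  measurableSet_isGeneric.inter (measurableSet_isReduced.inter
    ((measurableSet_le (continuous_abs.measurable.comp (measurable_entry 0 1))
      measurable_const).inter (measurableSet_lt measurable_const (measurable_entry 1 1))))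

theorem measurableSet_visitDomain : MeasurableSet visitDomain := by
  refine measurableSet_isGeneric.inter (measurableSet_isReduced.inter
    ((measurableSet_lt measurable_const (measurable_entry 1 1)).inter
      ((measurableSet_lt measurable_crossTime measurable_const).inter ?_)))
  change MeasurableSet {g | ∀ γ, IsReduced (toReal γ * g) →
    crossTime (toReal γ * g) ≤ crossTime g ∨ 0 ≤ crossTime (toReal γ * g)}
  simp only [Set.ofPred_forall]
  refine MeasurableSet.iInter fun γ => ?_
  have hγ := (measurePreserving_mul_left (toReal γ)).measurable
  have h1 : MeasurableSet {g | IsReduced (toReal γ * g)} := hγ measurableSet_isReduced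
  have h2 := measurableSet_le (measurable_crossTime.comp hγ) measurable_crossTime
  have h3 := measurableSet_le (measurable_const (a := (0 : ℝ))) (measurable_crossTime.comp hγ)
  exact h1.himp (h2.union h3)

instance : MeasurableConstSMul Γ SL(2, ℝ) :=
  ⟨fun c => (measurePreserving_mul_left (c : SL(2, ℝ))).measurable⟩

instance : SMulInvariantMeasure Γ SL(2, ℝ) haar :=
  ⟨fun c _ hs => (measurePreserving_mul_left (c : SL(2, ℝ))).measure_preimage
    hs.nullMeasurableSet⟩

theorem isFundamentalDomain_of {F : Set SL(2, ℝ)} (hF : MeasurableSet F)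
    (hcover : ∀ g, IsGeneric g → ∃ γ, toReal γ * g ∈ F)
    (huniq : ∀ g γ, g ∈ F → toReal γ * g ∈ F → γ = 1) : IsFundamentalDomain Γ F haar where
  nullMeasurableSet := hF.nullMeasurableSet
  ae_covers := by
    filter_upwards [ae_isGeneric] with g hg
    obtain ⟨γ, hγ⟩ := hcover g hg
    exact ⟨⟨toReal γ, toReal_mem γ⟩, hγ⟩
  aedisjoint := by
    intro γ δ hne
    refine Disjoint.aedisjoint (Set.disjoint_left.2 ?_)
    rintro _ ⟨f, hf, rfl⟩ ⟨f', hf', he⟩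
    obtain ⟨η, hη⟩ := exists_toReal_eq (δ⁻¹ * γ).2
    have h1 : toReal η * f = f' := by
      rw [← hη]
      change δ • f' = γ • f at he
      change (δ⁻¹ * γ) • f = f'
      rw [mul_smul, ← he, inv_smul_smul]
    have h2 := huniq f η hf (by rw [h1]; exact hf')
    rw [h2, toReal_one] at hη
    have h3 : δ⁻¹ * γ = 1 := Subtype.ext hη
    exact hne (inv_mul_eq_one.1 h3).symm

theorem isFundamentalDomain_columnDomain : IsFundamentalDomain Γ columnDomain haar :=
  isFundamentalDomain_of measurableSet_columnDomain (fun _ => exists_mem_columnDomain)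
    fun _ _ => eq_one_of_mem_columnDomain

theorem isFundamentalDomain_visitDomain : IsFundamentalDomain Γ visitDomain haar :=
  isFundamentalDomain_of measurableSet_visitDomain (fun _ => exists_mem_visitDomain)
    fun _ _ => eq_one_of_mem_visitDomain

/-! ### The invariant measure on the quotient -/

theorem proj_eq_iff {g h : SL(2, ℝ)} : proj g = proj h ↔ ∃ γ, h = toReal γ * g := by
  refine (Quotient.eq (r := QuotientGroup.rightRel Γ)).trans ?_
  rw [QuotientGroup.rightRel_apply]
  constructor
  · intro hm
    obtain ⟨γ, hγ⟩ := exists_toReal_eq hm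
    exact ⟨γ, by rw [← hγ, inv_mul_cancel_right]⟩
  · rintro ⟨γ, rfl⟩
    rw [mul_inv_cancel_right]; exact toReal_mem γ

theorem proj_surjective : Function.Surjective proj := Quotient.mk_surjective

theorem proj_toReal_mul (γ : SL(2, ℤ)) (g : SL(2, ℝ)) : proj (toReal γ * g) = proj g :=
  (proj_eq_iff.2 ⟨γ, rfl⟩).symm

instance : ContinuousConstSMul Γ SL(2, ℝ) := ⟨fun c => continuous_const_mul (c : SL(2, ℝ))⟩

theorem isOpenQuotientMap_proj : IsOpenQuotientMap proj where
  surjective := proj_surjective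
  continuous := continuous_quot_mk
  isOpenMap := isOpenMap_quotient_mk'_mul (Γ := Γ) (T := SL(2, ℝ))

theorem measurable_proj : Measurable proj := isOpenQuotientMap_proj.continuous.measurable

instance : SecondCountableTopology X2 :=
  ContinuousConstSMul.secondCountableTopology (Γ := Γ) (T := SL(2, ℝ))

theorem continuous_act_prod : Continuous fun x : X2 × SL(2, ℝ) => x.1.act x.2 := by
  have h := isOpenQuotientMap_proj.prodMap (IsOpenQuotientMap.id (X := SL(2, ℝ)))
  rw [h.isQuotientMap.continuous_iff]
  exact isOpenQuotientMap_proj.continuous.comp continuous_mul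

theorem measurable_act_prod : Measurable fun x : X2 × SL(2, ℝ) => x.1.act x.2 :=
  continuous_act_prod.measurable

theorem measurable_act (h : SL(2, ℝ)) : Measurable fun x : X2 => x.act h :=
  measurable_act_prod.comp (by fun_prop : Measurable fun x : X2 => (x, h))

theorem act_act (x : X2) (g h : SL(2, ℝ)) : (x.act g).act h = x.act (g * h) := by
  obtain ⟨k, rfl⟩ := proj_surjective x
  rw [proj_act, proj_act, proj_act, mul_assoc]

theorem act_one (x : X2) : x.act 1 = x := by
  obtain ⟨k, rfl⟩ := proj_surjective x
  rw [proj_act, mul_one]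

/-- The invariant measure on `X₂` induced by `haar`. -/
def quotMeasure : Measure X2 := (haar.restrict columnDomain).map proj

theorem smul_preimage_proj (A : Set X2) (γ : Γ) :
    (fun g : SL(2, ℝ) => γ • g) ⁻¹' (proj ⁻¹' A) = proj ⁻¹' A := by
  obtain ⟨δ, hδ⟩ := exists_toReal_eq γ.2
  ext g
  change proj ((γ : SL(2, ℝ)) * g) ∈ A ↔ proj g ∈ A
  rw [hδ, proj_toReal_mul]

theorem map_proj_restrict {F : Set SL(2, ℝ)} (hF : IsFundamentalDomain Γ F haar) :
    (haar.restrict F).map proj = quotMeasure := by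
  refine Measure.ext fun A hA => ?_
  rw [quotMeasure, Measure.map_apply measurable_proj hA, Measure.map_apply measurable_proj hA,
    Measure.restrict_apply (measurable_proj hA), Measure.restrict_apply (measurable_proj hA)]
  exact hF.measure_set_eq isFundamentalDomain_columnDomain (measurable_proj hA)
    (smul_preimage_proj A)

/-- Left and right multiplications commute, so a right translate of a fundamental domain is again
one, and it induces the same measure on the quotient. -/
theorem map_act_quotMeasure (h : SL(2, ℝ)) : quotMeasure.map (fun x => x.act h) = quotMeasure := by
  set s := (fun g => g * h⁻¹) ⁻¹' columnDomain with hs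
  have hpre : (fun g => g * h) ⁻¹' s = columnDomain := by
    ext g; simp [hs]
  have hfd : IsFundamentalDomain Γ s haar :=
    isFundamentalDomain_columnDomain.preimage_of_equiv (e := id)
      (measurePreserving_mul_right h⁻¹).quasiMeasurePreserving Function.bijective_id
      (fun γ g => mul_assoc (γ : SL(2, ℝ)) g h⁻¹)
  have hmp := (measurePreserving_mul_right h).restrict_preimage
    ((measurable_mul_right h⁻¹) measurableSet_columnDomain)
  rw [← hs, hpre] at hmp
  conv_rhs => rw [← map_proj_restrict hfd, ← hmp.map_eq,
    Measure.map_map measurable_proj hmp.measurable]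
  rw [quotMeasure, Measure.map_map (measurable_act h) measurable_proj]
  rfl

/-! ### Uniqueness of the invariant probability measure -/

theorem haar_preimage_proj_eq_zero {E : Set X2} (hE : MeasurableSet E) (h : quotMeasure E = 0) :
    haar (proj ⁻¹' E) = 0 := by
  rw [quotMeasure, Measure.map_apply measurable_proj hE,
    Measure.restrict_apply (measurable_proj hE)] at h
  refine isFundamentalDomain_columnDomain.measure_zero_of_invariant _ (fun γ => ?_) h
  have := smul_preimage_proj E γ⁻¹
  rwa [Set.preimage_smul, inv_inv] at this

/-- Apply Fubini to {(x, h) : xh ∈ E}. For fixed x the slice is a left translate of the preimage of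
E, hence null. For fixed h its measure is μ(E) by invariance. As `haar` is not zero, μ(E) = 0. -/
theorem IsHaarProb.absolutelyContinuous {μ : Measure X2} (hμ : IsHaarProb μ) :
    μ ≪ quotMeasure := by
  have := hμ.1
  refine Measure.AbsolutelyContinuous.mk fun E hE h0 => ?_
  have hz := haar_preimage_proj_eq_zero hE h0
  have hm : MeasurableSet {q : X2 × SL(2, ℝ) | q.1.act q.2 ∈ E} := measurable_act_prod hE
  have h1 : (μ.prod haar) {q : X2 × SL(2, ℝ) | q.1.act q.2 ∈ E} = 0 := by
    rw [Measure.measure_prod_null hm]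
    refine Filter.Eventually.of_forall fun x => ?_
    obtain ⟨g, rfl⟩ := proj_surjective x
    exact ((measurePreserving_mul_left g).measure_preimage
      (measurable_proj hE).nullMeasurableSet).trans hz
  rw [Measure.prod_apply_symm hm] at h1
  have h2 : ∀ h : SL(2, ℝ), μ ((fun x => (x, h)) ⁻¹' {q : X2 × SL(2, ℝ) | q.1.act q.2 ∈ E}) =
      μ E := by
    intro h
    conv_rhs => rw [← hμ.2 h, Measure.map_apply (measurable_act h) hE]
    rfl
  simp only [h2, lintegral_const] at h1
  refine (mul_eq_zero.1 h1).resolve_right fun hu => ?_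
  rw [haar, Measure.smul_apply, Measure.map_apply measurable_ofCoord MeasurableSet.univ,
    Set.preimage_univ, smul_eq_mul] at hu
  exact mul_ne_zero two_ne_zero (NeZero.ne _) hu

/-- The density f satisfies f(xh) = f(x) for almost every x, for each h. By Fubini some x₀ has
f(x₀h) = f(x₀) for almost every h, and the points x₀h fill X₂ up to a null set. -/
theorem IsHaarProb.eq_smul {μ : Measure X2} (hμ : IsHaarProb μ) [IsFiniteMeasure quotMeasure] :
    ∃ c : ℝ≥0∞, μ = c • quotMeasure := by
  have := hμ.1
  set f := μ.rnDeriv quotMeasure with hf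
  have hfm : Measurable f := Measure.measurable_rnDeriv _ _
  have hd : quotMeasure.withDensity f = μ :=
    Measure.withDensity_rnDeriv_eq _ _ hμ.absolutelyContinuous
  have hinv : ∀ h : SL(2, ℝ), ∀ᵐ x ∂quotMeasure, f (x.act h) = f x := by
    intro h
    have hmp : MeasurePreserving (fun x : X2 => x.act h) quotMeasure quotMeasure :=
      ⟨measurable_act h, map_act_quotMeasure h⟩
    have hfin : ∫⁻ x, f (x.act h) ∂quotMeasure ≠ ⊤ := by
      rw [hmp.lintegral_comp hfm, ← setLIntegral_univ, ← withDensity_apply _ MeasurableSet.univ, hd]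
      exact measure_ne_top _ _
    refine (withDensity_eq_iff (hfm.comp (measurable_act h)).aemeasurable hfm.aemeasurable
      hfin).1 ?_
    refine Measure.ext fun A hA => ?_
    set B := (fun x : X2 => x.act h⁻¹) ⁻¹' A with hB
    have hBm : MeasurableSet B := measurable_act _ hA
    have hA' : A = (fun x : X2 => x.act h) ⁻¹' B := by
      ext x; simp [hB, act_act, act_one]
    rw [withDensity_apply _ hA, hd]
    conv_lhs => rw [hA']
    have := hmp.setLIntegral_comp_preimage hBm hfm
    refine this.trans ?_
    rw [← withDensity_apply _ hBm, hd, hA', ← Measure.map_apply (measurable_act h) hBm, hμ.2 h]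
  have hinv' : ∀ᵐ x ∂quotMeasure, ∀ᵐ h ∂haar, f (x.act h) = f x := by
    refine (Measure.ae_ae_comm ?_).1 (Filter.Eventually.of_forall hinv)
    exact measurableSet_eq_fun (hfm.comp (measurable_act_prod.comp measurable_swap))
      (hfm.comp measurable_snd)
  have : NeZero quotMeasure := ⟨by
    intro h0
    have := hμ.absolutelyContinuous
    rw [h0, Measure.absolutelyContinuous_zero_iff] at this
    exact IsProbabilityMeasure.ne_zero μ this⟩
  obtain ⟨x₀, hx₀⟩ := hinv'.exists
  obtain ⟨g₀, rfl⟩ := proj_surjective x₀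
  refine ⟨f (proj g₀), ?_⟩
  have h1 : ∀ᵐ g ∂haar, f (proj g) = f (proj g₀) := by
    have := (measurePreserving_mul_left g₀⁻¹).quasiMeasurePreserving.ae hx₀
    filter_upwards [this] with g hg
    rwa [proj_act, mul_inv_cancel_left] at hg
  have h2 : ∀ᵐ x ∂quotMeasure, f x = f (proj g₀) := by
    rw [quotMeasure, ae_map_iff measurable_proj.aemeasurable
      (measurableSet_eq_fun hfm measurable_const)]
    exact ae_restrict_of_ae h1
  conv_lhs => rw [← hd]
  rw [withDensity_congr_ae h2, withDensity_const]

/-! ### The integral of -log y / (1 + y) -/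

/-- The primitive contains the factor y log y, which is continuous at 0, so that it can be used on
all of [0, 1]. -/
theorem hasDerivAt_pow_mul_log {x : ℝ} (hx : 0 < x) (n : ℕ) :
    HasDerivAt (fun y : ℝ => y ^ (n + 1) / (n + 1) ^ 2 - y ^ n * (y * Real.log y) / (n + 1))
      (-Real.log x * x ^ n) x := by
  have h1 := (hasDerivAt_pow (n + 1) x).div_const ((n + 1 : ℝ) ^ 2)
  have h2 := (hasDerivAt_pow (n + 1) x).mul (Real.hasDerivAt_log hx.ne')
  have h3 := h1.sub (h2.div_const (n + 1 : ℝ))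
  have hn : (n + 1 : ℝ) ≠ 0 := by positivity
  refine (h3.congr_deriv ?_).congr_of_eventuallyEq (Filter.Eventually.of_forall fun y => ?_)
  · push_cast
    field_simp
    ring
  · simp only [Pi.sub_apply, Pi.mul_apply]; ring

theorem integral_neg_log_mul_pow (n : ℕ) :
    IntegrableOn (fun y : ℝ => -Real.log y * y ^ n) (Set.Ioc 0 1) ∧
      ∫ y in Set.Ioc (0 : ℝ) 1, -Real.log y * y ^ n = 1 / ((n : ℝ) + 1) ^ 2 := by
  have hc : ContinuousOn (fun y : ℝ => y ^ (n + 1) / ((n : ℝ) + 1) ^ 2 -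
      y ^ n * (y * Real.log y) / (n + 1)) (Set.Icc 0 1) := by
    have := Real.continuous_mul_log
    fun_prop
  have hd : ∀ x ∈ Set.Ioo (0 : ℝ) 1, HasDerivAt (fun y : ℝ => y ^ (n + 1) / ((n : ℝ) + 1) ^ 2 -
      y ^ n * (y * Real.log y) / (n + 1)) (-Real.log x * x ^ n) x :=
    fun x hx => hasDerivAt_pow_mul_log hx.1 n
  have hi := intervalIntegral.integrableOn_deriv_of_nonneg hc hd
    (fun x hx => mul_nonneg (neg_nonneg.2 (Real.log_nonpos hx.1.le hx.2.le)) (pow_nonneg hx.1.le _))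
  refine ⟨hi, ?_⟩
  rw [← intervalIntegral.integral_of_le zero_le_one,
    intervalIntegral.integral_eq_sub_of_hasDerivAt_of_le zero_le_one hc hd
      ((intervalIntegrable_iff_integrableOn_Ioc_of_le zero_le_one).2 hi)]
  simp

theorem hasSum_of_eq {f g : ℕ → ℝ} {x y : ℝ} (h : HasSum f x) (hfg : ∀ k, g k = f k)
    (hxy : y = x) : HasSum g y := by
  obtain rfl : g = f := funext hfg
  rwa [hxy]

theorem hasSum_odd_sub_even : HasSum (fun k : ℕ => 1 / ((2 * k : ℕ) + 1 : ℝ) ^ 2 -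
    1 / ((2 * k + 1 : ℕ) + 1 : ℝ) ^ 2) (Real.pi ^ 2 / 12) := by
  have hz := hasSum_zeta_two
  have he : HasSum (fun k : ℕ => 1 / ((2 * k : ℕ) : ℝ) ^ 2) (Real.pi ^ 2 / 24) := by
    refine hasSum_of_eq (hz.mul_left (1 / 4)) (fun k => ?_) (by ring)
    push_cast; rw [mul_pow, one_div_mul_one_div]; norm_num
  have ho : Summable fun k : ℕ => 1 / ((2 * k + 1 : ℕ) : ℝ) ^ 2 :=
    hz.summable.comp_injective (i := fun k : ℕ => 2 * k + 1) (fun m n h => by simpa using h)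
  have hsum := (he.even_add_odd (f := fun n : ℕ => 1 / (n : ℝ) ^ 2) ho.hasSum).unique hz
  -- The shift only drops the term k = 0, which is 1/0 = 0.
  have he' : HasSum (fun k : ℕ => 1 / ((2 * (k + 1) : ℕ) : ℝ) ^ 2) (Real.pi ^ 2 / 24) := by
    rw [hasSum_nat_add_iff (f := fun k : ℕ => 1 / ((2 * k : ℕ) : ℝ) ^ 2) 1]
    simpa using he
  refine hasSum_of_eq (ho.hasSum.sub he') (fun k => ?_) (by linarith)
  push_cast; ring

/-- Expand 1/(1 + y) as an alternating geometric series. Pairing consecutive terms makes every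
summand nonnegative, so sum and integral may be exchanged. -/
theorem lintegral_neg_log_div :
    ∫⁻ y in Set.Ioc (0 : ℝ) 1, ENNReal.ofReal (-Real.log y / (1 + y)) =
      ENNReal.ofReal (Real.pi ^ 2 / 12) := by
  have hnn : ∀ (y : ℝ), y ∈ Set.Ioc (0 : ℝ) 1 → ∀ k : ℕ,
      0 ≤ -Real.log y * y ^ (2 * k) - -Real.log y * y ^ (2 * k + 1) := by
    intro y hy k
    have h1 : 0 ≤ -Real.log y := neg_nonneg.2 (Real.log_nonpos hy.1.le hy.2)
    have h2 : y ^ (2 * k + 1) ≤ y ^ (2 * k) := pow_le_pow_of_le_one hy.1.le hy.2 (by omega)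
    nlinarith
  have hexp : ∀ᵐ y : ℝ ∂volume.restrict (Set.Ioc 0 1), ENNReal.ofReal (-Real.log y / (1 + y)) =
      ∑' k : ℕ, ENNReal.ofReal (-Real.log y * y ^ (2 * k) - -Real.log y * y ^ (2 * k + 1)) := by
    rw [ae_restrict_iff' measurableSet_Ioc]
    filter_upwards [(by simp [ae_iff] : ∀ᵐ y : ℝ, y ≠ 1)] with y hy1 hy
    have hlt : y < 1 := lt_of_le_of_ne hy.2 hy1
    have hsq : y ^ 2 < 1 := by nlinarith [hy.1]
    have hs : HasSum (fun k : ℕ => -Real.log y * y ^ (2 * k) - -Real.log y * y ^ (2 * k + 1))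
        (-Real.log y / (1 + y)) := by
      refine hasSum_of_eq ((hasSum_geometric_of_lt_one (sq_nonneg y) hsq).mul_left
        (-Real.log y * (1 - y))) (fun k => ?_) ?_
      · rw [← pow_mul]; ring
      · have h1 : 1 + y ≠ 0 := by linarith [hy.1]
        have h2 : 1 - y ^ 2 ≠ 0 := by linarith
        field_simp
        ring
    rw [← hs.tsum_eq, ENNReal.ofReal_tsum_of_nonneg (hnn y hy) hs.summable]
  rw [lintegral_congr_ae hexp, lintegral_tsum]
  · have hterm : ∀ k : ℕ, ∫⁻ y in Set.Ioc (0 : ℝ) 1,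
        ENNReal.ofReal (-Real.log y * y ^ (2 * k) - -Real.log y * y ^ (2 * k + 1)) =
        ENNReal.ofReal (1 / ((2 * k : ℕ) + 1 : ℝ) ^ 2 - 1 / ((2 * k + 1 : ℕ) + 1 : ℝ) ^ 2) := by
      intro k
      obtain ⟨i1, e1⟩ := integral_neg_log_mul_pow (2 * k)
      obtain ⟨i2, e2⟩ := integral_neg_log_mul_pow (2 * k + 1)
      rw [← e1, ← e2, ← integral_sub i1 i2]
      refine (ofReal_integral_eq_lintegral_ofReal (i1.sub i2) ?_).symm
      exact (ae_restrict_iff' measurableSet_Ioc).2 (Filter.Eventually.of_forall fun y hy =>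
        hnn y hy k)
    simp only [hterm]
    rw [← ENNReal.ofReal_tsum_of_nonneg _ hasSum_odd_sub_even.summable, hasSum_odd_sub_even.tsum_eq]
    intro k
    rw [sub_nonneg]
    gcongr
    omega
  · intro k
    have := Real.measurable_log
    fun_prop

/-! ### The total mass -/

theorem isReduced_endMat_iff {p : ℝ × ℝ × ℤˣ} (hp : 0 < p.1) :
    IsReduced (endMat p) ↔ p ∈ Ytilde := by
  have hs := unit_sq p.2.2
  have habs : |((p.2.2 : ℤ) : ℝ)| = 1 := by
    rcases Int.units_eq_one_or p.2.2 with h | h <;> simp [h]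
  have e : IsReduced (endMat p) ↔ 0 < 1 - p.1 * p.2.1 ∧ -(p.1 * p.2.1) < 0 ∧
      |p.2.1| ≤ |1 - p.1 * p.2.1| ∧ |p.1| < 1 := by
    have h : -(p.1 * p.2.1) = (((p.2.2 : ℤ) : ℝ) * p.1) * -(((p.2.2 : ℤ) : ℝ) * p.2.1) := by
      linear_combination p.1 * p.2.1 * hs
    rw [h]
    simp [IsReduced, endMat, abs_mul, habs]
  rw [e, abs_of_pos hp]
  constructor
  · rintro ⟨h1, h2, h3, h4⟩
    have hz : 0 < p.2.1 := pos_of_mul_pos_right (by linarith) hp.le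
    rw [abs_of_pos hz, abs_of_pos h1] at h3
    exact ⟨hp, h4, hz, by rw [le_div_iff₀ (by linarith)]; linarith⟩
  · intro h
    have h5 := mem_Ytilde_aux h
    obtain ⟨h1, h2, h3, h4⟩ := h
    have h6 := mul_pos h1 h3
    rw [abs_of_pos h3, abs_of_pos (by linarith)]
    exact ⟨by linarith, by linarith, by linarith, h2⟩

theorem measurable_endMat_shift {τ : ℝ × ℝ × ℤˣ → ℝ} (hτ : Measurable τ) :
    Measurable fun q : (ℝ × ℝ × ℤˣ) × ℝ => endMat q.1 * a (τ q.1 + q.2) :=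
  measurable_endMat_mul_a.comp (by fun_prop : Measurable fun q : (ℝ × ℝ × ℤˣ) × ℝ =>
    (q.1, τ q.1 + q.2))

theorem ae_isGeneric_endMat {τ : ℝ × ℝ × ℤˣ → ℝ} (hτ : Measurable τ) :
    ∀ᵐ q ∂coordMeasure, IsGeneric (endMat q.1 * a (τ q.1 + q.2)) := by
  have h : ∀ᵐ g ∂coordMeasure.map (fun q => endMat q.1 * a (τ q.1 + q.2)), IsGeneric g := by
    rw [map_coordMeasure hτ]; exact ae_restrict_of_ae ae_isGeneric
  exact ae_of_ae_map (measurable_endMat_shift hτ).aemeasurable h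

theorem ae_coordMeasure_pos : ∀ᵐ q ∂coordMeasure, 0 < q.1.1 :=
  ae_restrict_mem (measurableSet_lt measurable_const measurable_fst.fst)

theorem measurableSet_Ytilde : MeasurableSet Ytilde :=
  (measurableSet_lt measurable_const measurable_fst).inter
    ((measurableSet_lt measurable_fst measurable_const).inter
      ((measurableSet_lt measurable_const measurable_snd.fst).inter
        (measurableSet_le measurable_snd.fst (measurable_const.div
          (measurable_const.add measurable_fst)))))

theorem lebY_prod_roof : (lebY.prod (volume : Measure ℝ))
    {q | q.1 ∈ Ytilde ∧ q.2 ∈ Set.Ioc 0 (-2 * Real.log q.1.1)} =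
      ENNReal.ofReal (Real.pi ^ 2 / 3) := by
  have hlog := Real.measurable_log
  have hS : MeasurableSet {q : (ℝ × ℝ × ℤˣ) × ℝ |
      q.1 ∈ Ytilde ∧ q.2 ∈ Set.Ioc 0 (-2 * Real.log q.1.1)} :=
    (measurable_fst measurableSet_Ytilde).inter
      ((measurableSet_lt measurable_const measurable_snd).inter
        (measurableSet_le measurable_snd (by fun_prop)))
  rw [Measure.prod_apply hS]
  have hsec : ∀ p : ℝ × ℝ × ℤˣ, volume (Prod.mk p ⁻¹' {q : (ℝ × ℝ × ℤˣ) × ℝ |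
      q.1 ∈ Ytilde ∧ q.2 ∈ Set.Ioc 0 (-2 * Real.log q.1.1)}) =
      Ytilde.indicator (fun p => ENNReal.ofReal (-2 * Real.log p.1)) p := by
    intro p
    by_cases hp : p ∈ Ytilde
    · rw [Set.indicator_of_mem hp]
      have : Prod.mk p ⁻¹' {q : (ℝ × ℝ × ℤˣ) × ℝ |
          q.1 ∈ Ytilde ∧ q.2 ∈ Set.Ioc 0 (-2 * Real.log q.1.1)} =
          Set.Ioc 0 (-2 * Real.log p.1) := by ext t; simp [hp]
      rw [this, Real.volume_Ioc, sub_zero]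
    · rw [Set.indicator_of_notMem hp]
      have : Prod.mk p ⁻¹' {q : (ℝ × ℝ × ℤˣ) × ℝ |
          q.1 ∈ Ytilde ∧ q.2 ∈ Set.Ioc 0 (-2 * Real.log q.1.1)} = ∅ := by ext t; simp [hp]
      rw [this, measure_empty]
  have hm : Measurable (Ytilde.indicator
      (fun p : ℝ × ℝ × ℤˣ => ENNReal.ofReal (-2 * Real.log p.1))) :=
    (by fun_prop : Measurable fun p : ℝ × ℝ × ℤˣ =>
      ENNReal.ofReal (-2 * Real.log p.1)).indicator measurableSet_Ytilde
  simp only [hsec]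
  rw [lebY, lintegral_prod _ hm.aemeasurable]
  have hy : ∀ y : ℝ, ∫⁻ v, Ytilde.indicator (fun p => ENNReal.ofReal (-2 * Real.log p.1)) (y, v)
      ∂((volume : Measure ℝ).prod (Measure.count : Measure ℤˣ)) =
      (Set.Ioo (0 : ℝ) 1).indicator
        (fun y => 4 * ENNReal.ofReal (-Real.log y / (1 + y))) y := by
    intro y
    by_cases hy : y ∈ Set.Ioo (0 : ℝ) 1
    · have hpos : 0 < 1 + y := by linarith [hy.1]
      have hl : 0 ≤ -Real.log y := neg_nonneg.2 (Real.log_nonpos hy.1.le hy.2.le)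
      have : (fun v : ℝ × ℤˣ => Ytilde.indicator
          (fun p => ENNReal.ofReal (-2 * Real.log p.1)) (y, v)) =
          (Set.Ioc 0 (1 / (1 + y)) ×ˢ (Set.univ : Set ℤˣ)).indicator
            (fun _ => ENNReal.ofReal (-2 * Real.log y)) := by
        funext v
        simp only [Set.indicator, Ytilde]
        congr 1
        simp [hy.1, hy.2]
      rw [this, lintegral_indicator_const (measurableSet_Ioc.prod MeasurableSet.univ),
        Measure.prod_prod, Real.volume_Ioc, sub_zero, Set.indicator_of_mem hy]
      have hc : (Measure.count : Measure ℤˣ) Set.univ = ENNReal.ofReal 2 := by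
        rw [Measure.count_univ]; simp
      rw [hc, ← ENNReal.ofReal_ofNat 4, ← ENNReal.ofReal_mul (by positivity),
        ← ENNReal.ofReal_mul (by linarith), ← ENNReal.ofReal_mul (by norm_num)]
      congr 1; field_simp; norm_num; ring
    · have : (fun v : ℝ × ℤˣ => Ytilde.indicator
          (fun p => ENNReal.ofReal (-2 * Real.log p.1)) (y, v)) = fun _ => 0 := by
        funext v
        exact Set.indicator_of_notMem (fun h => hy ⟨h.1, h.2.1⟩) _
      rw [this, lintegral_zero, Set.indicator_of_notMem hy]
  simp only [hy]
  rw [lintegral_indicator measurableSet_Ioo, setLIntegral_congr Ioo_ae_eq_Ioc,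
    lintegral_const_mul' _ _ ENNReal.ofNat_ne_top, lintegral_neg_log_div,
    ← ENNReal.ofReal_ofNat 4, ← ENNReal.ofReal_mul (by norm_num)]
  congr 1; ring

/-- For `endMat p * a s` one has D = e^{s/2} and |B| = y e^{s/2}, so |B| ≤ 1 < D means 0 < s ≤ -2
log y. -/
theorem haar_columnDomain : haar columnDomain = ENNReal.ofReal (Real.pi ^ 2 / 3) := by
  have hτ : Measurable fun _ : ℝ × ℝ × ℤˣ => (0 : ℝ) := measurable_const
  have hsub : columnDomain ⊆ {g : SL(2, ℝ) | 0 < g 1 1} := fun g hg => zero_lt_one.trans hg.2.2.2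
  rw [← Measure.restrict_eq_self haar hsub, ← map_coordMeasure hτ,
    Measure.map_apply (measurable_endMat_shift hτ) measurableSet_columnDomain, ← lebY_prod_roof]
  have hsub' : {q : (ℝ × ℝ × ℤˣ) × ℝ | q.1 ∈ Ytilde ∧ q.2 ∈ Set.Ioc 0 (-2 * Real.log q.1.1)} ⊆
      {q | 0 < q.1.1} := fun q hq => hq.1.1
  rw [← Measure.restrict_eq_self (lebY.prod volume) hsub', ← coordMeasure]
  refine measure_congr (Filter.eventuallyEq_set.2 ?_)
  filter_upwards [ae_isGeneric_endMat hτ, ae_coordMeasure_pos] with q hq hpos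
  obtain ⟨h00, h01, h10, h11⟩ := endMat_mul_a_apply q.1 q.2
  simp only [zero_add] at hq ⊢
  have habs : |((q.1.2.2 : ℤ) : ℝ)| = 1 := by
    rcases Int.units_eq_one_or q.1.2.2 with h | h <;> simp [h]
  have h1 : 1 < Real.exp (q.2 / 2) ↔ 0 < q.2 := by
    rw [Real.one_lt_exp_iff]; constructor <;> intro h <;> linarith
  have h2 : q.1.1 * Real.exp (q.2 / 2) ≤ 1 ↔ q.2 ≤ -2 * Real.log q.1.1 := by
    rw [← Real.exp_log hpos, ← Real.exp_add, Real.exp_le_one_iff, Real.log_exp]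
    constructor <;> intro h <;> linarith
  change _ ∧ _ ∧ _ ∧ _ ↔ _
  rw [isReduced_mul_a, isReduced_endMat_iff hpos, h01, h11, h1, abs_mul, abs_mul, habs, one_mul,
    abs_of_pos hpos, Real.abs_exp, h2]
  exact ⟨fun h => ⟨h.2.1, h.2.2.2, h.2.2.1⟩, fun h => ⟨hq, h.1, h.2.2, h.2.1⟩⟩

theorem quotMeasure_univ : quotMeasure Set.univ = ENNReal.ofReal (Real.pi ^ 2 / 3) := by
  rw [quotMeasure, Measure.map_apply measurable_proj MeasurableSet.univ, Set.preimage_univ,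
    Measure.restrict_apply_univ, haar_columnDomain]

instance : IsFiniteMeasure quotMeasure := ⟨by rw [quotMeasure_univ]; exact ENNReal.ofReal_lt_top⟩

/-! ### The suspension over the cross-section -/

/-- The time from `endMat p` to the cross-section. -/
def sectionShift (p : ℝ × ℝ × ℤˣ) : ℝ := Real.log (p.2.1 * (1 - p.1 * p.2.1) / p.1) / 2

theorem measurable_sectionShift : Measurable sectionShift := by
  have := Real.measurable_log
  unfold sectionShift
  fun_prop

theorem crossMat_mul_a (p : ℝ × ℝ × ℤˣ) (t : ℝ) :
    crossMat p * a t = endMat p * a (sectionShift p + t) := by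
  rw [a_add, ← mul_assoc]; rfl

theorem measurable_crossMat_mul_a :
    Measurable fun q : (ℝ × ℝ × ℤˣ) × ℝ => crossMat q.1 * a q.2 := by
  simp only [crossMat_mul_a]
  exact measurable_endMat_shift measurable_sectionShift

theorem map_crossMat_coordMeasure :
    coordMeasure.map (fun q => crossMat q.1 * a q.2) = haar.restrict {g | 0 < g 1 1} := by
  simp only [crossMat_mul_a]
  exact map_coordMeasure measurable_sectionShift

theorem act_mem_piC_iff {g : SL(2, ℝ)} {t : ℝ} :
    (proj g).act (a t) ∈ piC ↔ ∃ γ, toReal γ * g * a t ∈ C := by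
  rw [proj_act]
  constructor
  · rintro ⟨h, hC, he⟩
    obtain ⟨γ, hγ⟩ := proj_eq_iff.1 he.symm
    exact ⟨γ, by rwa [mul_assoc, ← hγ]⟩
  · rintro ⟨γ, hγ⟩
    exact ⟨_, hγ, by rw [mul_assoc, proj_toReal_mul]⟩

theorem mul_a_mem_C_iff {g : SL(2, ℝ)} {t : ℝ} :
    g * a t ∈ C ↔ IsReduced g ∧ t = crossTime g := by
  rw [mem_C_iff, isReduced_mul_a]
  exact ⟨fun h => ⟨h.2, (h.2.mul_a_mem_ASO2_iff t).1 h.1⟩,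
    fun h => ⟨(h.1.mul_a_mem_ASO2_iff t).2 h.2, h.1⟩⟩

/-- If every visit is later than `t`, then so is the return time, as visits do not accumulate. -/
theorem lt_returnTime {g : SL(2, ℝ)} {t : ℝ}
    (h : ∀ t', 0 < t' → (proj g).act (a t') ∈ piC → t < t') : (t : EReal) < returnTime (proj g) := by
  set F : Set ℝ := {t' | 0 < t' ∧ (proj g).act (a t') ∈ piC ∧ t' ≤ t + 1} with hF
  have hfin : F.Finite := by
    refine ((finite_crossings g (|t| + 1)).image fun γ => crossTime (toReal γ * g)).subset ?_
    rintro t' ⟨h0, hC, h1⟩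
    have h2 := h t' h0 hC
    obtain ⟨γ, hγ⟩ := act_mem_piC_iff.1 hC
    obtain ⟨hr, he⟩ := mul_a_mem_C_iff.1 hγ
    refine ⟨γ, ⟨t', ?_, (mem_C_iff.1 hγ).1⟩, he.symm⟩
    rw [abs_of_pos h0]; linarith [le_abs_self t]
  -- Inserting t + 1 makes the finite set nonempty, and its minimum still exceeds t.
  obtain ⟨b, hb, hmin⟩ := Set.exists_min_image (insert (t + 1) F) id (hfin.insert _)
    ⟨_, Set.mem_insert _ _⟩
  have htb : t < b := by
    rcases hb with rfl | hb
    · linarith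
    · exact h b hb.1 hb.2.1
  refine lt_of_lt_of_le (EReal.coe_lt_coe_iff.2 htb) (le_sInf ?_)
  rintro _ ⟨t', ⟨h0, hC⟩, rfl⟩
  rw [EReal.coe_le_coe_iff]
  rcases le_or_gt t' (t + 1) with h1 | h1
  · exact hmin t' (Set.mem_insert_of_mem _ ⟨h0, hC, h1⟩)
  · exact (hmin _ (Set.mem_insert _ _)).trans h1.le

/-- On the flow line of `crossMat p`, the starting visit is at time 0, and γ gives a visit at time t
plus its crossing time seen from time t. So the last visit before t is the starting one exactly when
none lies in (0, t). Genericity excludes a visit at t itself, which gives the strict inequality with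
r_C. -/
theorem mem_visitDomain_iff {q : (ℝ × ℝ × ℤˣ) × ℝ} (hpos : 0 < q.1.1)
    (hgen : IsGeneric (crossMat q.1 * a q.2)) :
    crossMat q.1 * a q.2 ∈ visitDomain ↔ q ∈ Yhat := by
  obtain ⟨p, t⟩ := q
  simp only at hpos hgen ⊢
  have hred : IsReduced (crossMat p * a t) ↔ p ∈ Ytilde := by
    rw [isReduced_mul_a, crossMat, isReduced_mul_a, isReduced_endMat_iff hpos]
  have h11 : 0 < (crossMat p * a t) 1 1 := by
    rw [crossMat_mul_a, (endMat_mul_a_apply _ _).2.2.2]; exact Real.exp_pos _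
  have htime : p ∈ Ytilde → crossTime (crossMat p * a t) = -t := by
    intro hp
    have hC := (crossMat_spec hp).1
    rw [← mul_one (crossMat p), ← a_zero, mul_a_mem_C_iff] at hC
    rw [hC.1.crossTime_mul_a, ← hC.2, zero_sub]
  have hshift : ∀ (γ : SL(2, ℤ)) (t' : ℝ), toReal γ * crossMat p * a t' ∈ C ↔
      IsReduced (toReal γ * (crossMat p * a t)) ∧
        t' = t + crossTime (toReal γ * (crossMat p * a t)) := by
    intro γ t'
    rw [mul_a_mem_C_iff, ← mul_assoc, isReduced_mul_a]
    refine and_congr_right fun hr => ?_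
    rw [hr.crossTime_mul_a, add_sub_cancel]
  constructor
  · rintro ⟨-, h1, -, h3, h4⟩
    have hp := hred.1 h1
    rw [htime hp] at h3 h4
    refine ⟨hp, by simp only; linarith, lt_returnTime fun t' h0 hC => ?_⟩
    obtain ⟨γ, hγ⟩ := act_mem_piC_iff.1 hC
    obtain ⟨hr, he⟩ := (hshift γ t').1 hγ
    have hne : crossTime (toReal γ * (crossMat p * a t)) ≠ 0 := by
      intro hz
      have := (hr.mul_a_mem_ASO2_iff 0).2 hz.symm
      rw [a_zero, mul_one] at this
      exact hgen.2 γ this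
    have h5 : 0 < crossTime (toReal γ * (crossMat p * a t)) := by
      rcases h4 γ hr with h | h
      · linarith
      · exact lt_of_le_of_ne h hne.symm
    linarith
  · rintro ⟨hp, h0, hlt⟩
    simp only at h0 hlt
    refine ⟨hgen, hred.2 hp, h11, by rw [htime hp]; linarith, fun γ hr => ?_⟩
    rw [htime hp]
    by_contra hcon
    push Not at hcon
    have hmem : toReal γ * crossMat p * a (t + crossTime (toReal γ * (crossMat p * a t))) ∈ C :=
      (hshift γ _).2 ⟨hr, rfl⟩
    have hle : returnTime (crossPoint p) ≤
        ((t + crossTime (toReal γ * (crossMat p * a t)) : ℝ) : EReal) :=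
      sInf_le ⟨_, ⟨by linarith, act_mem_piC_iff.2 ⟨γ, hmem⟩⟩, rfl⟩
    have := EReal.coe_lt_coe_iff.1 (hlt.trans_le hle)
    linarith

theorem Yhat_subset : Yhat ⊆ {q | 0 < q.1.1} := fun _ hq => hq.1.1

theorem suspMeasure_eq : suspMeasure = coordMeasure.restrict Yhat := by
  rw [coordMeasure, Measure.restrict_restrict_of_subset Yhat_subset, suspMeasure]

theorem preimage_visitDomain_ae_eq :
    (fun q : (ℝ × ℝ × ℤˣ) × ℝ => crossMat q.1 * a q.2) ⁻¹' visitDomain =ᵐ[coordMeasure] Yhat := by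
  refine Filter.eventuallyEq_set.2 ?_
  have h := ae_isGeneric_endMat measurable_sectionShift
  simp only [← crossMat_mul_a] at h
  filter_upwards [h, ae_coordMeasure_pos] with q hq hpos
  exact mem_visitDomain_iff hpos hq

theorem measurable_θ : Measurable θ := measurable_proj.comp measurable_crossMat_mul_a

theorem map_θ_suspMeasure : suspMeasure.map θ = quotMeasure := by
  have hsub : visitDomain ⊆ {g : SL(2, ℝ) | 0 < g 1 1} := fun g hg => hg.2.2.1
  rw [← map_proj_restrict isFundamentalDomain_visitDomain,
    ← Measure.restrict_restrict_of_subset hsub, ← map_crossMat_coordMeasure,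
    Measure.restrict_map measurable_crossMat_mul_a measurableSet_visitDomain,
    Measure.restrict_congr_set preimage_visitDomain_ae_eq, ← suspMeasure_eq,
    Measure.map_map measurable_proj measurable_crossMat_mul_a]
  rfl

/-- Measurability modulo null sets is inherited from `visitDomain`, so the return time need not be
shown measurable. -/
theorem nullMeasurableSet_Yhat : NullMeasurableSet Yhat (lebY.prod (volume : Measure ℝ)) := by
  have hpos : MeasurableSet {q : (ℝ × ℝ × ℤˣ) × ℝ | 0 < q.1.1} :=
    measurableSet_lt measurable_const measurable_fst.fst
  have h : NullMeasurableSet Yhat coordMeasure :=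
    (measurable_crossMat_mul_a measurableSet_visitDomain).nullMeasurableSet.congr
      preimage_visitDomain_ae_eq
  rw [coordMeasure, nullMeasurableSet_restrict hpos.nullMeasurableSet,
    Set.inter_eq_left.2 Yhat_subset] at h
  exact h

/-! ### Test functions and the orbit formula -/

instance : LocallyCompactSpace SL(2, ℝ) := isClosedEmbedding_entries.locallyCompactSpace

instance : ProperlyDiscontinuousSMul Γ SL(2, ℝ) :=
  Subgroup.properlyDiscontinuousSMul_of_tendsto_cofinite Γ
    (Γ.tendsto_coe_cofinite_of_discrete
      ⟨Matrix.SpecialLinearGroup.discreteSpecialLinearGroupIntRangeSL⟩)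

instance : T2Space X2 :=
  t2Space_of_properlyDiscontinuousSMul_of_t2Space (Γ := Γ) (T := SL(2, ℝ))

instance : LocallyCompactSpace X2 := isOpenQuotientMap_proj.locallyCompactSpace

/-- Such a function is what determines κ in the orbit formula. -/
theorem exists_integral_pos (μ : Measure X2) [IsProbabilityMeasure μ] :
    ∃ f : X2 → ℝ, Continuous f ∧ HasCompactSupport f ∧ 0 < ∫ x, f x ∂μ := by
  obtain ⟨n, hn⟩ : ∃ n, μ (compactCovering X2 n) ≠ 0 := by
    by_contra! hcon
    have := measure_iUnion_null hcon
    rw [iUnion_compactCovering, measure_univ] at this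
    exact one_ne_zero this
  have hK := isCompact_compactCovering X2 n
  obtain ⟨f, hf1, -, hfc, hf01⟩ := exists_continuous_one_zero_of_isCompact hK isClosed_empty
    (Set.disjoint_empty _)
  refine ⟨f, f.continuous, hfc, ?_⟩
  have hint : Integrable f μ := f.continuous.integrable_of_hasCompactSupport hfc
  calc 0 < μ.real (compactCovering X2 n) := ENNReal.toReal_pos hn (measure_ne_top _ _)
    _ = ∫ x in compactCovering X2 n, f x ∂μ := by
      rw [setIntegral_congr_fun hK.measurableSet hf1]; simp
    _ ≤ ∫ x, f x ∂μ := setIntegral_le_integral hint (Filter.Eventually.of_forall fun x => (hf01 x).1)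

instance : SFinite lebY := by unfold lebY; infer_instance

instance : IsFiniteMeasure suspMeasure := ⟨by
  have h : suspMeasure.map θ Set.univ = quotMeasure Set.univ := by rw [map_θ_suspMeasure]
  rw [Measure.map_apply measurable_θ MeasurableSet.univ, Set.preimage_univ] at h
  rw [h]; exact measure_lt_top _ _⟩

theorem integral_quotMeasure {f : X2 → ℝ} (hf : Continuous f) (hc : HasCompactSupport f) :
    ∫ x, f x ∂quotMeasure = ∫ p in Ytilde,
      (∫ t in {t : ℝ | 0 < t ∧ (t : EReal) < returnTime (crossPoint p)},
        f ((crossPoint p).act (a t))) ∂lebY := by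
  have hint : Integrable (fun q => f (θ q)) suspMeasure := by
    have := hf.integrable_of_hasCompactSupport hc (μ := quotMeasure)
    rw [← map_θ_suspMeasure] at this
    exact this.comp_measurable measurable_θ
  rw [← map_θ_suspMeasure, integral_map measurable_θ.aemeasurable hf.aestronglyMeasurable]
  have hint' : Integrable (Yhat.indicator fun q => f (θ q)) (lebY.prod volume) :=
    IntegrableOn.integrable_indicator₀ hint nullMeasurableSet_Yhat
  rw [suspMeasure, ← integral_indicator₀ nullMeasurableSet_Yhat, integral_prod _ hint',
    ← integral_indicator measurableSet_Ytilde]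
  refine integral_congr_ae (Filter.Eventually.of_forall fun p => ?_)
  have hS : MeasurableSet {t : ℝ | 0 < t ∧ (t : EReal) < returnTime (crossPoint p)} :=
    (measurableSet_lt measurable_const measurable_id).inter
      (measurableSet_lt measurable_coe_real_ereal measurable_const)
  by_cases hp : p ∈ Ytilde
  · simp only
    rw [Set.indicator_of_mem hp, ← integral_indicator hS]
    refine integral_congr_ae (Filter.Eventually.of_forall fun t => ?_)
    have : (p, t) ∈ Yhat ↔ t ∈ {t : ℝ | 0 < t ∧ (t : EReal) < returnTime (crossPoint p)} :=
      ⟨fun h => h.2, fun h => ⟨hp, h⟩⟩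
    by_cases ht : (p, t) ∈ Yhat
    · simp only
      rw [Set.indicator_of_mem ht, Set.indicator_of_mem (this.1 ht)]; rfl
    · simp only
      rw [Set.indicator_of_notMem ht, Set.indicator_of_notMem (fun h => ht (this.2 h))]
  · simp only
    rw [Set.indicator_of_notMem hp]
    have : ∀ t, (Yhat.indicator fun q => f (θ q)) (p, t) = 0 := fun t =>
      Set.indicator_of_notMem (fun h => hp h.1) _
    simp [this]

/-! ### Normalisation and the value of κ -/

/-- The normalised invariant measure. -/
def haarProb : Measure X2 := ENNReal.ofReal (3 / Real.pi ^ 2) • quotMeasure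

/-- No sign condition on κ is needed: `ENNReal.ofReal` is 0 for κ ≤ 0, and the product is then not
1. -/
theorem ofReal_mul_quotMeasure_univ (κ : ℝ) :
    ENNReal.ofReal κ * quotMeasure Set.univ = 1 ↔ κ = 3 / Real.pi ^ 2 := by
  have hpi : 0 < Real.pi ^ 2 := by positivity
  rw [quotMeasure_univ, ← ENNReal.ofReal_mul' (by positivity), ENNReal.ofReal_eq_one,
    eq_div_iff hpi.ne']
  constructor <;> intro h <;> linarith

theorem isHaarProb_haarProb : IsHaarProb haarProb := by
  refine ⟨⟨?_⟩, fun h => ?_⟩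
  · rw [haarProb, Measure.smul_apply, smul_eq_mul, ofReal_mul_quotMeasure_univ]
  · rw [haarProb, Measure.map_smul, map_act_quotMeasure]

theorem IsHaarProb.eq_haarProb {μ : Measure X2} (hμ : IsHaarProb μ) : μ = haarProb := by
  have := hμ.1
  obtain ⟨c, rfl⟩ := hμ.eq_smul
  have h1 : c * quotMeasure Set.univ = 1 := by
    rw [← smul_eq_mul, ← Measure.smul_apply]; exact measure_univ
  have h2 := (ofReal_mul_quotMeasure_univ (3 / Real.pi ^ 2)).2 rfl
  have h0 : quotMeasure Set.univ ≠ 0 := right_ne_zero_of_mul_eq_one h1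
  rw [haarProb, (ENNReal.mul_left_inj h0 (measure_ne_top _ _)).1 (h1.trans h2.symm)]

theorem orbitFormula_iff (κ : ℝ) : OrbitFormula haarProb κ ↔ κ = 3 / Real.pi ^ 2 := by
  have hpos : (0 : ℝ) ≤ 3 / Real.pi ^ 2 := by positivity
  have key : ∀ f : X2 → ℝ, ∫ x, f x ∂haarProb = 3 / Real.pi ^ 2 * ∫ x, f x ∂quotMeasure := by
    intro f
    rw [haarProb, integral_smul_measure, ENNReal.toReal_ofReal hpos, smul_eq_mul]
  constructor
  · intro h
    have := isHaarProb_haarProb.1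
    obtain ⟨f, hf, hc, hfpos⟩ := exists_integral_pos haarProb
    have h1 := h f hf hc
    rw [← integral_quotMeasure hf hc, key] at h1
    rw [key] at hfpos
    exact (mul_right_cancel₀ (right_ne_zero_of_mul hfpos.ne') h1).symm
  · rintro rfl f hf hc
    rw [← integral_quotMeasure hf hc, key]

theorem smul_map_θ_eq_haarProb_iff (κ : ℝ) :
    ENNReal.ofReal κ • suspMeasure.map θ = haarProb ↔ κ = 3 / Real.pi ^ 2 := by
  rw [map_θ_suspMeasure]
  constructor
  · intro h
    have := isHaarProb_haarProb.1
    rw [← ofReal_mul_quotMeasure_univ, ← smul_eq_mul, ← Measure.smul_apply, h]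
    exact measure_univ
  · rintro rfl
    rfl

end GaussFlow

end

theorem theorem4 :
    (∃! μ : MeasureTheory.Measure GaussFlow.X2, GaussFlow.IsHaarProb μ) ∧
    (∀ μ : MeasureTheory.Measure GaussFlow.X2, GaussFlow.IsHaarProb μ → ∀ κ : ℝ,
      (GaussFlow.OrbitFormula μ κ ↔ κ = 3 / Real.pi ^ 2) ∧
      (ENNReal.ofReal κ • GaussFlow.suspMeasure.map GaussFlow.θ = μ ↔ κ = 3 / Real.pi ^ 2)) ∧
    ((3 / Real.pi ^ 2 : ℝ) : ℂ) = 1 / (2 * riemannZeta 2) := by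
  refine ⟨⟨GaussFlow.haarProb, GaussFlow.isHaarProb_haarProb, fun μ hμ => hμ.eq_haarProb⟩,
    fun μ hμ κ => ?_, ?_⟩
  · rw [hμ.eq_haarProb]
    exact ⟨GaussFlow.orbitFormula_iff κ, GaussFlow.smul_map_θ_eq_haarProb_iff κ⟩
  · have hpi : (Real.pi : ℂ) ≠ 0 := Complex.ofReal_ne_zero.2 Real.pi_ne_zero
    rw [riemannZeta_two]
    push_cast
    field_simp
    norm_num
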